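/- Let $n,r\in\mathbb{Z}_{>0}$. Let $S(r,\ell)$ be the number of partitions of an $r$-element set into $\ell$ nonempty subsets, let $B(r)$ be the number of all partitions of an $r$-element set into nonempty subsets, let $[i]=\frac{q^i-1}{q-1}=1+q+\cdots+q^{i-1}$, and define the polynomial $$d_{n,r}(q)=\sum_{\ell=1}^{n}S(r,\ell)\,[n][n-1]\cdots[n-\ell+1]\in\mathbb{Z}[q].$$ Let $\Lambda_n^r=\{\lambda=(\lambda_1,\ldots,\lambda_t)\vdash n : \lambda_2+\cdots+\lambda_t\le r\}$. For $\lambda\vdash n$, let $f^\lambda_n(q)=\sum_T q^{\mathrm{maj}(T)}$, where $T$ runs over the standard tableaux of shape $\lambda$ (entries $1,\ldots,n$) and $\mathrm{maj}(T)$ is the sum of those $i$ such that $i+1$ lies in a lower row of $T$ than $i$. Let $m^\lambda_r$ be the number of $r$-vacillating tableaux of shape $\lambda$, that is, of sequences of partitions $$\bigl((n)=\lambda^{(0)},\lambda^{(\frac12)},\lambda^{(1)},\ldots,\lambda^{(r-\frac12)},\lambda^{(r)}=\lambda\bigr)$$ in which, for $0\le i\le r-1$, $\lambda^{(i+\frac12)}\vdash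 n-1$ is obtained from $\lambda^{(i)}\vdash n$ by deleting a box and $\lambda^{(i+1)}\vdash n$ is obtained from $\lambda^{(i+\frac12)}$ by adding a box. Then, as polynomials in $q$, $$d_{n,r}(q)=\sum_{\lambda\in\Lambda_n^r}f^\lambda_n(q)\,m^\lambda_r .$$ In particular $d_{n,r}(1)=n^r$, and $d_{n,r}(0)=B(r)$ if $n\ge r$. -/

import Mathlib

noncomputable section

namespace QPartition

/-- Partitions of `n`, as Young diagrams with `n` boxes
(rows are numbered downwards and columns rightwards, both from `0`). -/
abbrev Shape (n : ℕ) : Type := {μ : YoungDiagram // μ.card = n}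

theorem cells_subset_box (μ : YoungDiagram) :
    μ.cells ⊆ Finset.range μ.card ×ˢ Finset.range μ.card := by
  rintro ⟨i, j⟩ h
  have h' : (i, j) ∈ μ := h
  have h1 : i < μ.colLen j := YoungDiagram.mem_iff_lt_colLen.mp h'
  have h2 : j < μ.rowLen i := YoungDiagram.mem_iff_lt_rowLen.mp h'
  have h3 : μ.colLen j ≤ μ.card := by
    rw [YoungDiagram.colLen_eq_card]
    exact Finset.card_le_card (Finset.filter_subset _ _)
  have h4 : μ.rowLen i ≤ μ.card := by
    rw [YoungDiagram.rowLen_eq_card]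
    exact Finset.card_le_card (Finset.filter_subset _ _)
  simp only [Finset.mem_product, Finset.mem_range]
  omega

instance finiteShape (n : ℕ) : Finite (Shape n) := by
  let g : Shape n → (Finset.range n ×ˢ Finset.range n).powerset := fun μ =>
    ⟨μ.1.cells, Finset.mem_powerset.mpr (by
      have h := cells_subset_box μ.1
      rwa [μ.2] at h)⟩
  refine Finite.of_injective g fun μ ν h => ?_
  exact Subtype.ext (YoungDiagram.ext (congrArg Subtype.val h))

instance fintypeShape (n : ℕ) : Fintype (Shape n) := Fintype.ofFinite _

/-- The one-row partition `(n)`. -/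
def oneRow (n : ℕ) : Shape n :=
  ⟨{ cells := {0} ×ˢ Finset.range n
     isLowerSet := by
      rintro ⟨a, b⟩ ⟨c, d⟩ h h'
      simp only [Prod.mk_le_mk] at h
      simp only [Finset.coe_product, Set.mem_prod, Finset.mem_coe, Finset.mem_singleton,
        Finset.mem_range] at h' ⊢
      omega },
   by simp [YoungDiagram.card]⟩

/-- `ν` is obtained from `μ` by adding a box (so `μ` is obtained from `ν` by deleting a box). -/
def AddBox (μ ν : YoungDiagram) : Prop := μ ≤ ν ∧ ν.card = μ.card + 1

open Classical in
/-- `Λ_n^r`: the partitions `(λ₁, λ₂, …, λ_t)` of `n` with `λ₂ + ⋯ + λ_t ≤ r`. -/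
def Lam (n r : ℕ) : Finset (Shape n) :=
  Finset.univ.filter fun μ => ∑ i ∈ Finset.Ico 1 (μ.1.colLen 0), μ.1.rowLen i ≤ r

/-- Standard tableaux of shape `μ ⊢ n`: bijective fillings of the boxes with `1, …, n` that increase
along rows and down columns. -/
def StandardTableau {n : ℕ} (μ : Shape n) : Type :=
  {T : μ.1.cells ≃ Finset.Icc 1 n //
    (∀ c d : μ.1.cells, c.1.1 = d.1.1 → c.1.2 < d.1.2 → (T c : ℕ) < T d) ∧
    (∀ c d : μ.1.cells, c.1.2 = d.1.2 → c.1.1 < d.1.1 → (T c : ℕ) < T d)}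

instance fintypeStandardTableau {n : ℕ} (μ : Shape n) : Fintype (StandardTableau μ) := by
  classical
  unfold StandardTableau
  exact Subtype.fintype _

open Classical in
/-- The descents of `T`: those `i` such that `i + 1` is in a lower row than `i`. -/
def StandardTableau.descents {n : ℕ} {μ : Shape n} (T : StandardTableau μ) : Finset ℕ :=
  (Finset.Icc 1 n).filter fun i =>
    ∃ c d : μ.1.cells, (T.1 c : ℕ) = i ∧ (T.1 d : ℕ) = i + 1 ∧ c.1.1 < d.1.1

/-- The major index, the sum of the descents. -/
def StandardTableau.maj {n : ℕ} {μ : Shape n} (T : StandardTableau μ) : ℕ :=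
  ∑ i ∈ T.descents, i

/-- `f^μ_n(q) = ∑_T q^{maj T}`, over the standard tableaux `T` of shape `μ`. -/
def fPoly {n : ℕ} (μ : Shape n) : Polynomial ℤ :=
  ∑ T : StandardTableau μ, Polynomial.X ^ T.maj

/-- The `r`-vacillating tableaux of shape `μ ⊢ n`: pairs of a sequence
`λ⁽⁰⁾, λ⁽¹⁾, …, λ⁽ʳ⁾` of partitions of `n` and a sequence `λ^(1/2), …, λ^(r-1/2)` of partitions of
`n - 1`, starting at `(n)` and ending at `μ`, such that `λ^(i+1/2)` is obtained from `λ^(i)` by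
deleting a box and `λ^(i+1)` from `λ^(i+1/2)` by adding a box. -/
def VacillatingTableau {n : ℕ} (r : ℕ) (μ : Shape n) : Type :=
  {Q : (Fin (r + 1) → Shape n) × (Fin r → Shape (n - 1)) //
    Q.1 0 = oneRow n ∧
    (∀ i : Fin r, AddBox (Q.2 i).1 (Q.1 i.castSucc).1) ∧
    (∀ i : Fin r, AddBox (Q.2 i).1 (Q.1 i.succ).1) ∧
    Q.1 (Fin.last r) = μ}

instance fintypeVacillatingTableau {n : ℕ} (r : ℕ) (μ : Shape n) :
    Fintype (VacillatingTableau r μ) := by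
  classical
  unfold VacillatingTableau
  exact Subtype.fintype _

/-- `m^μ_r`, the number of `r`-vacillating tableaux of shape `μ`. -/
def mult {n : ℕ} (r : ℕ) (μ : Shape n) : ℕ := Fintype.card (VacillatingTableau r μ)

/-- `S(r, ℓ)`, the number of partitions of an `r`-element set into `ℓ` nonempty subsets. -/
def stirling (r l : ℕ) : ℕ :=
  Fintype.card {P : Finpartition (Finset.univ : Finset (Fin r)) // P.parts.card = l}

/-- `B(r)`, the number of partitions of an `r`-element set into nonempty subsets. -/
def bellNumber (r : ℕ) : ℕ := Fintype.card (Finpartition (Finset.univ : Finset (Fin r)))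

/-- The `q`-integer `[i] = (q^i - 1) / (q - 1) = 1 + q + ⋯ + q^{i-1}`. -/
def qInt (i : ℕ) : Polynomial ℤ := ∑ k ∈ Finset.range i, Polynomial.X ^ k

/-- `d_{n,r}(q) = ∑_{ℓ=1}^n S(r, ℓ) [n] [n-1] ⋯ [n-ℓ+1]`. -/
def dPoly (n r : ℕ) : Polynomial ℤ :=
  ∑ l ∈ Finset.Icc 1 n, (stirling r l : Polynomial ℤ) * ∏ i ∈ Finset.range l, qInt (n - i)

end QPartition

end

/-! Let U and D act on functions on Young's lattice by adding and deleting a box, and let δ_k be the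
indicator of the row (k). An r-vacillating tableau is a walk from (n) that alternates deletions and
additions, so m^λ_r is the coefficient of λ in (UD)^r δ_n (`mult_eq`). Since DU = UD + 1 and D δ_k =
δ_{k-1}, normal ordering turns this into the sum over ℓ of S(r,ℓ) U^ℓ δ_{n-ℓ}
(`upOp_mul_downOp_pow_rowInd`).

Now pair with λ ↦ f^λ. Summing f^λ over the λ that cover μ ⊢ n gives [n+1] f^μ (`sum_above_majSum`),
so each U contributes one q-integer. As f^{(k)} = 1, the ℓ-th term becomes S(r,ℓ) [n]⋯[n-ℓ+1]. Only
λ in Λ_n^r matter, because each step of the walk takes at most one box from the first row.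

The covering identity is the Pieri rule for s_1 s_μ at the variables 1, q, q², …, where s_μ becomes
f^μ / ((1-q)⋯(1-q^n)). It is reached without symmetric functions. Deleting the largest entry of a
tableau shows that this quotient is the sum of q^{|ν|} s_ν over horizontal strips μ/ν
(`spec_eq_sum_strips`), which amounts to splitting off the variable 1. Any solution of that
recursion satisfies the Pieri rule (`sum_above_of_sum_strips`), by commuting box addition with strip
removal (`ncard_addBox_hStrip`). The same commutation yields DU = UD + 1.

At q = 1 the polynomial counts functions by their fibres; at q = 0 every [i] with i > 0 is 1. -/

namespace QPartition

open Finset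

/-! ### Young diagrams through their row lengths -/

/-- `ν` is obtained from `μ` by adding a box at the end of row `i`. -/
def AddAt (i : ℕ) (μ ν : YoungDiagram) : Prop :=
  ∀ j, ν.rowLen j = μ.rowLen j + if j = i then 1 else 0

/-- `μ / ν` is a horizontal strip: the row lengths of `ν` and `μ` interlace. -/
def HStrip (ν μ : YoungDiagram) : Prop :=
  ∀ j, ν.rowLen j ≤ μ.rowLen j ∧ μ.rowLen (j + 1) ≤ ν.rowLen j

theorem ext_rowLen {μ ν : YoungDiagram} (h : ∀ j, μ.rowLen j = ν.rowLen j) : μ = ν := by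
  apply YoungDiagram.ext
  ext ⟨i, j⟩
  rw [YoungDiagram.mem_cells, YoungDiagram.mem_cells, YoungDiagram.mem_iff_lt_rowLen,
    YoungDiagram.mem_iff_lt_rowLen, h]

theorem le_iff_rowLen {μ ν : YoungDiagram} : μ ≤ ν ↔ ∀ j, μ.rowLen j ≤ ν.rowLen j := by
  constructor
  · intro h i
    by_contra! hlt
    have : (i, ν.rowLen i) ∈ ν := h (YoungDiagram.mem_iff_lt_rowLen.mpr hlt)
    exact lt_irrefl _ (YoungDiagram.mem_iff_lt_rowLen.mp this)
  · rintro h ⟨i, j⟩ hij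
    exact YoungDiagram.mem_iff_lt_rowLen.mpr ((YoungDiagram.mem_iff_lt_rowLen.mp hij).trans_le (h i))

theorem rowLen_eq_zero {μ : YoungDiagram} {i : ℕ} (h : μ.card ≤ i) : μ.rowLen i = 0 := by
  by_contra hne
  have hmem : (i, 0) ∈ μ.cells :=
    YoungDiagram.mem_iff_lt_rowLen.mpr (Nat.pos_of_ne_zero hne)
  have := cells_subset_box μ hmem
  simp only [mem_product, mem_range] at this
  omega

theorem card_eq_sum_rowLen (μ : YoungDiagram) {N : ℕ} (h : ∀ i, N ≤ i → μ.rowLen i = 0) :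
    μ.card = ∑ i ∈ range N, μ.rowLen i := by
  have hmap : ∀ c ∈ μ.cells, c.1 ∈ range N := by
    rintro ⟨i, j⟩ hc
    rw [mem_range]
    by_contra! hi
    have := YoungDiagram.mem_iff_lt_rowLen.mp ((YoungDiagram.mem_cells _).mp hc)
    rw [h i hi] at this
    exact absurd this (Nat.not_lt_zero _)
  rw [YoungDiagram.card, card_eq_sum_card_fiberwise hmap]
  refine sum_congr rfl fun i _ => ?_
  rw [YoungDiagram.rowLen_eq_card]
  rfl

theorem card_le_of_le {μ ν : YoungDiagram} (h : μ ≤ ν) : μ.card ≤ ν.card :=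
  card_le_card h

theorem eq_of_le_of_card {μ ν : YoungDiagram} (h : μ ≤ ν) (hc : ν.card ≤ μ.card) : μ = ν :=
  YoungDiagram.ext (eq_of_subset_of_card_le h hc)

/-- A weakly decreasing sequence that is eventually zero is the sequence of row lengths of a
Young diagram. -/
theorem exists_rowLen_eq (f : ℕ → ℕ) (hf : Antitone f) {N : ℕ} (hN : ∀ i, N ≤ i → f i = 0) :
    ∃ μ : YoungDiagram, ∀ j, μ.rowLen j = f j := by
  refine ⟨⟨{c ∈ range N ×ˢ range (f 0) | c.2 < f c.1}, ?_⟩, fun i => ?_⟩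
  · rintro ⟨a, b⟩ ⟨c, d⟩ hle hmem
    simp only [coe_filter, Set.mem_ofPred_eq, mem_product, mem_range] at hmem ⊢
    obtain ⟨h3, h4⟩ := Prod.mk_le_mk.mp hle
    have := hf h3
    omega
  · refine eq_of_forall_lt_iff fun j => ?_
    rw [← YoungDiagram.mem_iff_lt_rowLen]
    change (i, j) ∈ ({c ∈ range N ×ˢ range (f 0) | c.2 < f c.1} : Finset (ℕ × ℕ)) ↔ _
    simp only [mem_filter, mem_product, mem_range]
    refine ⟨fun h => h.2, fun h => ⟨⟨?_, h.trans_le (hf (Nat.zero_le i))⟩, h⟩⟩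
    by_contra! hi
    rw [hN i hi] at h
    omega

theorem AddAt.le {i : ℕ} {μ ν : YoungDiagram} (h : AddAt i μ ν) : μ ≤ ν :=
  le_iff_rowLen.mpr fun j => by rw [h j]; exact Nat.le_add_right _ _

theorem AddAt.card {i : ℕ} {μ ν : YoungDiagram} (h : AddAt i μ ν) : ν.card = μ.card + 1 := by
  obtain ⟨N, hN⟩ : ∃ N, N = μ.card + ν.card + i + 1 := ⟨_, rfl⟩
  have h1 : ∀ j, N ≤ j → μ.rowLen j = 0 := fun j hj => rowLen_eq_zero (by omega)
  have h2 : ∀ j, N ≤ j → ν.rowLen j = 0 := fun j hj => rowLen_eq_zero (by omega)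
  rw [card_eq_sum_rowLen ν h2, card_eq_sum_rowLen μ h1, sum_congr rfl fun j _ => h j,
    sum_add_distrib, sum_ite_eq', if_pos (mem_range.mpr (by omega))]

theorem AddAt.addBox {i : ℕ} {μ ν : YoungDiagram} (h : AddAt i μ ν) : AddBox μ ν :=
  ⟨h.le, h.card⟩

/-- The differences of row lengths are natural numbers with sum 1, so exactly one of them is
nonzero. -/
theorem AddBox.exists_addAt {μ ν : YoungDiagram} (h : AddBox μ ν) : ∃ i, AddAt i μ ν := by
  obtain ⟨hle, hc⟩ := h
  have hl := le_iff_rowLen.mp hle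
  have h1 : ∀ j, ν.card ≤ j → μ.rowLen j = 0 := fun j hj => rowLen_eq_zero (by omega)
  have h2 : ∀ j, ν.card ≤ j → ν.rowLen j = 0 := fun j hj => rowLen_eq_zero (by omega)
  have hsum : ∑ j ∈ range ν.card, (ν.rowLen j - μ.rowLen j) = 1 := by
    rw [sum_tsub_distrib _ fun j _ => hl j, ← card_eq_sum_rowLen ν h2, ← card_eq_sum_rowLen μ h1]
    omega
  obtain ⟨i, hi, hne⟩ := exists_ne_zero_of_sum_ne_zero (hsum.trans_ne one_ne_zero)
  rw [← add_sum_erase _ _ hi] at hsum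
  have hz : ∑ j ∈ (range ν.card).erase i, (ν.rowLen j - μ.rowLen j) = 0 := by omega
  refine ⟨i, fun j => ?_⟩
  have hlj := hl j
  split_ifs with hji
  · subst hji
    omega
  · by_cases hj : ν.card ≤ j
    · rw [h1 j hj, h2 j hj]
    · have := sum_eq_zero_iff.mp hz j (mem_erase.mpr ⟨hji, mem_range.mpr (by omega)⟩)
      omega

theorem AddAt.row_unique {i j : ℕ} {μ ν : YoungDiagram} (hi : AddAt i μ ν) (hj : AddAt j μ ν) :
    i = j := by
  by_contra hne
  have h1 := hi i
  rw [hj i, if_pos rfl, if_neg hne] at h1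
  omega

theorem AddAt.right_unique {i : ℕ} {μ ν ν' : YoungDiagram} (h : AddAt i μ ν) (h' : AddAt i μ ν') :
    ν = ν' :=
  ext_rowLen fun j => by rw [h j, h' j]

theorem AddAt.left_unique {i : ℕ} {μ μ' ν : YoungDiagram} (h : AddAt i μ ν) (h' : AddAt i μ' ν) :
    μ = μ' :=
  ext_rowLen fun j => by have := h j; rw [h' j] at this; omega

/-! ### Horizontal strips and their commutation with adding a box -/

theorem HStrip.le {μ ν : YoungDiagram} (h : HStrip ν μ) : ν ≤ μ :=
  le_iff_rowLen.mpr fun j => (h j).1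

theorem HStrip.refl (μ : YoungDiagram) : HStrip μ μ :=
  fun j => ⟨le_rfl, μ.rowLen_anti _ _ (Nat.le_succ j)⟩

theorem AddAt.hStrip {i : ℕ} {μ ν : YoungDiagram} (h : AddAt i μ ν) : HStrip μ ν := by
  intro j
  have h1 := μ.rowLen_anti j (j + 1) (Nat.le_succ j)
  have h2 := ν.rowLen_anti j (j + 1) (Nat.le_succ j)
  have h3 := h j
  have h4 := h (j + 1)
  refine ⟨by omega, ?_⟩
  split_ifs at h3 h4 <;> omega

theorem hStrip_and_card_iff {ν μ : YoungDiagram} :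
    HStrip ν μ ∧ μ.card = ν.card + 1 ↔ AddBox ν μ := by
  constructor
  · rintro ⟨h, hc⟩
    exact ⟨h.le, hc⟩
  · intro h
    obtain ⟨i, hi⟩ := h.exists_addAt
    exact ⟨hi.hStrip, h.2⟩

/-- Rows in which a box can be added to `μ` so as to get a horizontal strip over `ν`. -/
theorem exists_addAt_hStrip_iff {i : ℕ} {μ ν : YoungDiagram} :
    (∃ l, AddAt i μ l ∧ HStrip ν l) ↔
      ∀ j, ν.rowLen j ≤ (μ.rowLen j + if j = i then 1 else 0) ∧
        (μ.rowLen (j + 1) + if j + 1 = i then 1 else 0) ≤ ν.rowLen j := by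
  constructor
  · rintro ⟨l, hl, hs⟩ j
    rw [← hl j, ← hl (j + 1)]
    exact hs j
  · intro h
    obtain ⟨l, hl⟩ := exists_rowLen_eq (fun j => μ.rowLen j + if j = i then 1 else 0)
      (antitone_nat_of_succ_le fun j => (h j).2.trans (h j).1) (N := μ.card + i + 1) fun j hj => by
        rw [rowLen_eq_zero (by omega), if_neg (by omega)]
    refine ⟨l, hl, fun j => ?_⟩
    rw [hl j, hl (j + 1)]
    exact h j

/-- Rows in which a box can be removed from `ν` so as to get a horizontal strip under `μ`. -/
theorem exists_hStrip_addAt_iff {i : ℕ} {μ ν : YoungDiagram} :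
    (∃ l, AddAt i l ν ∧ HStrip l μ) ↔
      ∀ j, ν.rowLen j ≤ (μ.rowLen j + if j = i then 1 else 0) ∧
        (μ.rowLen (j + 1) + if j = i then 1 else 0) ≤ ν.rowLen j := by
  constructor
  · rintro ⟨l, hl, hs⟩ j
    have h1 := hl j
    have h2 := hs j
    omega
  · intro h
    obtain ⟨l, hl⟩ := exists_rowLen_eq (fun j => ν.rowLen j - if j = i then 1 else 0)
      (antitone_nat_of_succ_le fun j => by
        have h1 := h j
        have h2 := h (j + 1)
        omega)
      (N := ν.card) fun j hj => by
        rw [rowLen_eq_zero (by omega), Nat.zero_sub]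
    refine ⟨l, fun j => ?_, fun j => ?_⟩
    · have h1 := h j
      rw [hl j]
      omega
    · have h1 := h j
      rw [hl j]
      omega

/-- The Pieri-type commutation rule for adding a box and removing a horizontal strip. -/
theorem ncard_addBox_hStrip (μ ν : YoungDiagram) [Decidable (HStrip ν μ)] :
    {l | AddBox μ l ∧ HStrip ν l}.ncard =
      {l | AddBox l ν ∧ HStrip l μ}.ncard + if HStrip ν μ then 1 else 0 := by
  have hA : {l | AddBox μ l ∧ HStrip ν l}.ncard = {i | ∃ l, AddAt i μ l ∧ HStrip ν l}.ncard := by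
    refine Set.ncard_congr (fun l h => h.1.exists_addAt.choose) ?_ ?_ ?_
    · intro l h
      exact ⟨l, h.1.exists_addAt.choose_spec, h.2⟩
    · intro l l' h h' heq
      have := h.1.exists_addAt.choose_spec
      rw [heq] at this
      exact this.right_unique h'.1.exists_addAt.choose_spec
    · rintro i ⟨l, hl, hs⟩
      exact ⟨l, ⟨hl.addBox, hs⟩, hl.addBox.exists_addAt.choose_spec.row_unique hl⟩
  have hB : {l | AddBox l ν ∧ HStrip l μ}.ncard = {i | ∃ l, AddAt i l ν ∧ HStrip l μ}.ncard := by
    refine Set.ncard_congr (fun l h => h.1.exists_addAt.choose) ?_ ?_ ?_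
    · intro l h
      exact ⟨l, h.1.exists_addAt.choose_spec, h.2⟩
    · intro l l' h h' heq
      have := h.1.exists_addAt.choose_spec
      rw [heq] at this
      exact this.left_unique h'.1.exists_addAt.choose_spec
    · rintro i ⟨l, hl, hs⟩
      exact ⟨l, ⟨hl.addBox, hs⟩, hl.addBox.exists_addAt.choose_spec.row_unique hl⟩
  rw [hA, hB]
  -- Both sides now count rows i. The two conditions differ only in where the extra box enters the
  -- second inequality: at j + 1 = i or at j = i.
  simp only [exists_addAt_hStrip_iff, exists_hStrip_addAt_iff]
  have hμ : ∀ j, μ.rowLen (j + 1) ≤ μ.rowLen j := fun j => μ.rowLen_anti _ _ (Nat.le_succ j)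
  have hν : ∀ j, ν.rowLen (j + 1) ≤ ν.rowLen j := fun j => ν.rowLen_anti _ _ (Nat.le_succ j)
  split_ifs with hs
  · set B := {i | ∀ j, ν.rowLen j ≤ (μ.rowLen j + if j = i then 1 else 0) ∧
        (μ.rowLen (j + 1) + if j = i then 1 else 0) ≤ ν.rowLen j} with hBdef
    -- Finiteness matters because `ncard` of an infinite set is 0.
    have hfin : B.Finite := by
      refine (Set.finite_lt_nat ν.card).subset fun i hi => ?_
      have := (hi i).2
      rw [if_pos rfl] at this
      by_contra hge
      rw [rowLen_eq_zero (not_lt.mp hge)] at this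
      omega
    -- For a strip μ/ν the first inequalities are automatic, and adding in row i + 1 imposes the
    -- same bound on ν_i as deleting in row i. Adding in row 0 is always allowed, which is the extra
    -- 1.
    have : {i | ∀ j, ν.rowLen j ≤ (μ.rowLen j + if j = i then 1 else 0) ∧
        (μ.rowLen (j + 1) + if j + 1 = i then 1 else 0) ≤ ν.rowLen j} =
          insert 0 (Nat.succ '' B) := by
      ext i
      simp only [Set.mem_ofPred_eq, Set.mem_insert_iff, Set.mem_image, hBdef]
      constructor
      · intro h
        rcases i with _ | i
        · exact Or.inl rfl
        · refine Or.inr ⟨i, fun j => ?_, rfl⟩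
          have h1 := (h j).2
          have h2 := hs j
          simp only [Nat.succ_inj] at h1
          exact ⟨by omega, h1⟩
      · rintro (rfl | ⟨i, h, rfl⟩) j
        · have h2 := hs j
          exact ⟨by omega, by rw [if_neg (by omega)]; omega⟩
        · have h1 := (h j).2
          have h2 := hs j
          simp only [Nat.succ_eq_add_one, Nat.succ_inj]
          exact ⟨by omega, h1⟩
    rw [this, Set.ncard_insert_of_notMem (by simp) (hfin.image _),
      Set.ncard_image_of_injective _ Nat.succ_injective]
  -- If μ/ν is not a strip, either condition forces ν_i = μ_i + 1. The inequality in which they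
  -- differ then follows from monotonicity of ν or of μ, so the two sets of rows coincide.
  · rw [add_zero]
    congr 1
    ext i
    simp only [Set.mem_ofPred_eq]
    constructor
    · intro h
      have hi : μ.rowLen i < ν.rowLen i := by
        by_contra! hle
        refine hs fun j => ⟨?_, le_of_add_le_left (h j).2⟩
        rcases eq_or_ne j i with rfl | hj
        · exact hle
        · have := (h j).1
          rwa [if_neg hj] at this
      intro j
      refine ⟨(h j).1, ?_⟩
      rcases eq_or_ne j i with rfl | hj
      · rw [if_pos rfl]
        exact (Nat.succ_le_succ (hμ j)).trans hi
      · rw [if_neg hj]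
        exact le_of_add_le_left (h j).2
    · intro h
      have hi : μ.rowLen i < ν.rowLen i := by
        by_contra! hle
        refine hs fun j => ⟨?_, le_of_add_le_left (h j).2⟩
        rcases eq_or_ne j i with rfl | hj
        · exact hle
        · have := (h j).1
          rwa [if_neg hj] at this
      intro j
      refine ⟨(h j).1, ?_⟩
      rcases eq_or_ne (j + 1) i with rfl | hj
      · rw [if_pos rfl]
        exact hi.trans_le (hν j)
      · rw [if_neg hj]
        exact le_of_add_le_left (h j).2

/-! ### Sums over covers and strips; the differential poset relation -/

theorem finite_setOf_card_le (n : ℕ) : {μ : YoungDiagram | μ.card ≤ n}.Finite := by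
  have : {μ : YoungDiagram | μ.card ≤ n} ⊆
      ⋃ m : Fin (n + 1), Set.range (Subtype.val : Shape m → YoungDiagram) := by
    intro μ hμ
    exact Set.mem_iUnion.mpr ⟨⟨μ.card, Nat.lt_succ_of_le hμ⟩, ⟨μ, rfl⟩, rfl⟩
  exact (Set.finite_iUnion fun m => Set.finite_range _).subset this

/-- The Young diagrams with at most `n` boxes. -/
noncomputable def diagrams (n : ℕ) : Finset YoungDiagram := (finite_setOf_card_le n).toFinset

theorem mem_diagrams {n : ℕ} {μ : YoungDiagram} : μ ∈ diagrams n ↔ μ.card ≤ n := by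
  simp [diagrams]

open Classical in
/-- The diagrams obtained from `μ` by adding a box. -/
noncomputable def above (μ : YoungDiagram) : Finset YoungDiagram :=
  {l ∈ diagrams (μ.card + 1) | AddBox μ l}

open Classical in
/-- The diagrams obtained from `μ` by deleting a box. -/
noncomputable def below (μ : YoungDiagram) : Finset YoungDiagram :=
  {l ∈ diagrams μ.card | AddBox l μ}

open Classical in
/-- The diagrams obtained from `μ` by deleting a horizontal strip. -/
noncomputable def strips (μ : YoungDiagram) : Finset YoungDiagram :=
  {l ∈ diagrams μ.card | HStrip l μ}

theorem mem_above {μ ν : YoungDiagram} : ν ∈ above μ ↔ AddBox μ ν := by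
  simp only [above, mem_filter, mem_diagrams, and_iff_right_iff_imp]
  exact fun h => h.2.le

theorem mem_below {μ ν : YoungDiagram} : ν ∈ below μ ↔ AddBox ν μ := by
  simp only [below, mem_filter, mem_diagrams, and_iff_right_iff_imp]
  exact fun h => card_le_of_le h.1

theorem mem_strips {μ ν : YoungDiagram} : ν ∈ strips μ ↔ HStrip ν μ := by
  simp only [strips, mem_filter, mem_diagrams, and_iff_right_iff_imp]
  exact fun h => card_le_of_le h.le

section Commutation

variable {M : Type*} [AddCommMonoid M]

/-- Collecting the coefficient of each φ ν reduces this to `ncard_addBox_hStrip`; all diagrams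
involved have at most |μ| + 1 boxes. -/
theorem sum_above_sum_strips (φ : YoungDiagram → M) (μ : YoungDiagram) :
    ∑ l ∈ above μ, ∑ ν ∈ strips l, φ ν =
      ∑ ρ ∈ strips μ, ∑ ν ∈ above ρ, φ ν + ∑ ν ∈ strips μ, φ ν := by
  classical
  have h1 : ∑ l ∈ above μ, ∑ ν ∈ strips l, φ ν =
      ∑ ν ∈ diagrams (μ.card + 1), {l | AddBox μ l ∧ HStrip ν l}.ncard • φ ν := by
    rw [sum_comm' (t' := diagrams (μ.card + 1)) (s' := fun ν => {l ∈ above μ | HStrip ν l})]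
    · refine sum_congr rfl fun ν _ => ?_
      rw [sum_const, ← Set.ncard_coe_finset]
      congr 2
      ext l
      simp [mem_above]
    · intro l ν
      simp only [mem_above, mem_strips, mem_filter, mem_diagrams]
      constructor
      · rintro ⟨h, hs⟩
        exact ⟨⟨h, hs⟩, h.2 ▸ card_le_of_le hs.le⟩
      · exact fun h => h.1
  have h2 : ∑ ρ ∈ strips μ, ∑ ν ∈ above ρ, φ ν =
      ∑ ν ∈ diagrams (μ.card + 1), {l | AddBox l ν ∧ HStrip l μ}.ncard • φ ν := by
    rw [sum_comm' (t' := diagrams (μ.card + 1)) (s' := fun ν => {l ∈ strips μ | AddBox l ν})]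
    · refine sum_congr rfl fun ν _ => ?_
      rw [sum_const, ← Set.ncard_coe_finset]
      congr 2
      ext l
      simp [mem_strips, and_comm]
    · intro l ν
      simp only [mem_above, mem_strips, mem_filter, mem_diagrams]
      constructor
      · rintro ⟨hs, h⟩
        exact ⟨⟨hs, h⟩, h.2 ▸ Nat.succ_le_succ (card_le_of_le hs.le)⟩
      · exact fun h => h.1
  have h3 : ∑ ν ∈ strips μ, φ ν =
      ∑ ν ∈ diagrams (μ.card + 1), (if HStrip ν μ then 1 else 0) • φ ν := by
    simp only [ite_smul, one_smul, zero_smul]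
    rw [← sum_filter]
    refine sum_congr (Finset.ext fun ν => ?_) fun _ _ => rfl
    simp only [mem_strips, mem_filter, mem_diagrams, iff_and_self]
    exact fun h => (card_le_of_le h.le).trans (Nat.le_succ _)
  rw [h1, h2, h3, ← sum_add_distrib]
  refine sum_congr rfl fun ν _ => ?_
  rw [← add_smul, ncard_addBox_hStrip]

/-- Young's lattice is a differential poset: `D U = U D + 1`. -/
theorem sum_above_sum_below (φ : YoungDiagram → M) (μ : YoungDiagram) :
    ∑ l ∈ above μ, ∑ ν ∈ below l, φ ν = ∑ ρ ∈ below μ, ∑ ν ∈ above ρ, φ ν + φ μ := by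
  classical
  -- Restricting φ to diagrams of size |μ| leaves only strips of one box, except in the last sum,
  -- where only the empty strip survives.
  have h := sum_above_sum_strips (fun ν => if ν.card = μ.card then φ ν else 0) μ
  have h1 : ∀ l ∈ above μ, ∑ ν ∈ strips l, (if ν.card = μ.card then φ ν else 0) =
      ∑ ν ∈ below l, φ ν := by
    intro l hl
    have hc := (mem_above.mp hl).2
    rw [← sum_filter]
    refine sum_congr (Finset.ext fun ν => ?_) fun _ _ => rfl
    rw [mem_filter, mem_strips, mem_below, ← hStrip_and_card_iff, hc, eq_comm,
      Nat.add_right_cancel_iff]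
  have h2 : ∑ ρ ∈ strips μ, ∑ ν ∈ above ρ, (if ν.card = μ.card then φ ν else 0) =
      ∑ ρ ∈ below μ, ∑ ν ∈ above ρ, φ ν := by
    have : ∀ ρ ∈ strips μ, ∑ ν ∈ above ρ, (if ν.card = μ.card then φ ν else 0) =
        if μ.card = ρ.card + 1 then ∑ ν ∈ above ρ, φ ν else 0 := by
      intro ρ _
      split_ifs with hc
      · exact sum_congr rfl fun ν hν => if_pos ((mem_above.mp hν).2.trans hc.symm)
      · exact sum_eq_zero fun ν hν => if_neg fun h =>
          hc (h.symm.trans (mem_above.mp hν).2)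
    rw [sum_congr rfl this, ← sum_filter]
    refine sum_congr (Finset.ext fun ν => ?_) fun _ _ => rfl
    rw [mem_filter, mem_strips, mem_below, hStrip_and_card_iff]
  have h3 : ∑ ν ∈ strips μ, (if ν.card = μ.card then φ ν else 0) = φ μ := by
    rw [sum_eq_single μ, if_pos rfl]
    · intro ν hν hne
      refine if_neg fun hc => hne (eq_of_le_of_card (mem_strips.mp hν).le hc.ge)
    · exact fun h => absurd (mem_strips.mpr (HStrip.refl μ)) h
  rw [sum_congr rfl h1, h2, h3] at h
  exact h

end Commutation

/-- A function given by summing over horizontal strips with weight `q` to the number of remaining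
boxes is multiplied by `1 / (1 - q)` under summing over the ways to add a box. -/
theorem sum_above_of_sum_strips {K : Type*} [Field K] {q : K} (hq : ∀ j, q ^ (j + 1) ≠ 1)
    {S : YoungDiagram → K} (hS : ∀ μ, S μ = ∑ ν ∈ strips μ, q ^ ν.card * S ν) (μ : YoungDiagram) :
    (1 - q) * ∑ l ∈ above μ, S l = S μ := by
  classical
  induction hn : μ.card using Nat.strong_induction_on generalizing μ with
  | _ n ih =>
    subst hn
    have h0 : ∑ l ∈ above μ, S l =
        ∑ ρ ∈ strips μ, q ^ (ρ.card + 1) * ∑ ν ∈ above ρ, S ν + S μ := by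
      rw [sum_congr rfl fun l _ => hS l, sum_above_sum_strips, ← hS μ]
      congr 1
      refine sum_congr rfl fun ρ _ => ?_
      rw [mul_sum]
      exact sum_congr rfl fun ν hν => by rw [(mem_above.mp hν).2]
    have hmem : μ ∈ strips μ := mem_strips.mpr (HStrip.refl μ)
    have h1 := hS μ
    -- The term ρ = μ is the unknown sum itself, times q^{|μ|+1}; smaller ρ are known by induction.
    -- Moving it to the left leaves the factor 1 - q^{|μ|+1}, which can be cancelled.
    rw [← add_sum_erase _ _ hmem] at h0 h1
    have h2 : (1 - q) * ∑ ρ ∈ (strips μ).erase μ, q ^ (ρ.card + 1) * ∑ ν ∈ above ρ, S ν =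
        q * ∑ ρ ∈ (strips μ).erase μ, q ^ ρ.card * S ρ := by
      rw [mul_sum, mul_sum]
      refine sum_congr rfl fun ρ hρ => ?_
      rw [mem_erase, mem_strips] at hρ
      have hlt : ρ.card < μ.card := by
        by_contra! hge
        exact hρ.1 (eq_of_le_of_card hρ.2.le hge)
      rw [← ih _ hlt ρ rfl]
      ring
    have hne : (1 - q ^ (μ.card + 1)) ≠ 0 := sub_ne_zero.mpr (hq _).symm
    apply mul_left_cancel₀ hne
    linear_combination (1 - q) * h0 + h2 - q * h1

/-! ### Set partitions and Stirling numbers -/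

theorem sum_finpartition_card_parts (r : ℕ) {N : ℕ} (g : ℕ → ℕ)
    (hg : ∀ l, N ≤ l → l ≤ r → g l = 0) :
    ∑ P : Finpartition (univ : Finset (Fin r)), g P.parts.card =
      ∑ l ∈ range N, stirling r l * g l := by
  have h1 : ∑ P : Finpartition (univ : Finset (Fin r)), g P.parts.card =
      ∑ P : Finpartition (univ : Finset (Fin r)) with P.parts.card ∈ range N, g P.parts.card := by
    rw [sum_filter_of_ne]
    intro P _ hne
    by_contra hN
    refine hne (hg _ (not_lt.mp fun h => hN (mem_range.mpr h)) ?_)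
    exact P.card_parts_le_card.trans_eq (by simp)
  have hmaps : ∀ P ∈ ({P | P.parts.card ∈ range N} :
      Finset (Finpartition (univ : Finset (Fin r)))), P.parts.card ∈ range N :=
    fun P hP => (mem_filter.mp hP).2
  rw [h1, ← sum_fiberwise_of_maps_to hmaps]
  refine sum_congr rfl fun l hl => ?_
  rw [sum_congr rfl fun P hP => congrArg g (mem_filter.mp hP).2, sum_const, smul_eq_mul, stirling,
    Fintype.card_subtype, filter_filter]
  congr 2
  ext P
  simp only [mem_filter, mem_univ, true_and, and_iff_right_iff_imp]
  rintro rfl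
  exact hl

theorem part_eq_part_iff {r n : ℕ} (P : Finpartition (univ : Finset (Fin r))) (e : P.parts ↪ Fin n)
    (a b : Fin r) : b ∈ P.part a ↔
      e ⟨P.part b, P.part_mem.mpr (mem_univ _)⟩ = e ⟨P.part a, P.part_mem.mpr (mem_univ _)⟩ := by
  rw [e.apply_eq_iff_eq, Subtype.mk.injEq, P.mem_part_iff_part_eq_part (mem_univ _) (mem_univ _)]

/-- Functions correspond to pairs of a partition (the fibres) and an injection on its parts. -/
theorem bijective_finpartition_embedding (r n : ℕ) : Function.Bijective
    fun (x : Σ P : Finpartition (univ : Finset (Fin r)), (P.parts ↪ Fin n)) (a : Fin r) =>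
      x.2 ⟨x.1.part a, x.1.part_mem.mpr (mem_univ _)⟩ := by
  classical
  constructor
  · rintro ⟨P, e⟩ ⟨P', e'⟩ h
    have h' : ∀ a, e ⟨P.part a, P.part_mem.mpr (mem_univ _)⟩ =
        e' ⟨P'.part a, P'.part_mem.mpr (mem_univ _)⟩ := fun a => congrFun h a
    have hpart : ∀ a, P.part a = P'.part a := fun a => by
      ext b
      rw [part_eq_part_iff P e, part_eq_part_iff P' e', h', h']
    obtain rfl : P = P' := by
      apply Finpartition.ext
      ext p
      constructor
      · intro hp
        obtain ⟨a, ha⟩ := P.nonempty_of_mem_parts hp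
        rw [← P.part_eq_of_mem hp ha, hpart]
        exact P'.part_mem.mpr (mem_univ _)
      · intro hp
        obtain ⟨a, ha⟩ := P'.nonempty_of_mem_parts hp
        rw [← P'.part_eq_of_mem hp ha, ← hpart]
        exact P.part_mem.mpr (mem_univ _)
    congr 1
    ext ⟨p, hp⟩
    obtain ⟨a, ha⟩ := P.nonempty_of_mem_parts hp
    have := h' a
    simp only [P.part_eq_of_mem hp ha] at this
    rw [this]
  · intro f
    set P := Finpartition.ofSetoid (Setoid.ker f)
    have hP : ∀ a b, b ∈ P.part a ↔ f a = f b := fun a b =>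
      Finpartition.mem_part_ofSetoid_iff_rel
    have key : ∀ p : P.parts, ∃ a, p.1 = P.part a := fun p => by
      obtain ⟨a, ha⟩ := P.nonempty_of_mem_parts p.2
      exact ⟨a, (P.part_eq_of_mem p.2 ha).symm⟩
    choose s hs using key
    refine ⟨⟨P, ⟨fun p => f (s p), fun p p' h => ?_⟩⟩, funext fun a => ?_⟩
    · apply Subtype.ext
      rw [hs p, hs p', ← P.mem_part_iff_part_eq_part (mem_univ _) (mem_univ _), hP]
      exact h.symm
    · have := hs ⟨P.part a, P.part_mem.mpr (mem_univ _)⟩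
      change f _ = f a
      rw [← hP, ← this, P.mem_part_self]
      exact mem_univ _

/-- Functions from an r-set to an n-set are classified by their partition into fibres; a partition
with ℓ parts arises from as many functions as there are injections of its parts. -/
theorem sum_stirling_mul_descFactorial (r n : ℕ) :
    ∑ l ∈ range (n + 1), stirling r l * n.descFactorial l = n ^ r := by
  rw [← sum_finpartition_card_parts r (fun l => n.descFactorial l)
    fun l hl _ => Nat.descFactorial_eq_zero_iff_lt.mpr hl]
  have := Fintype.card_of_bijective (bijective_finpartition_embedding r n)
  rw [Fintype.card_sigma, Fintype.card_fun, Fintype.card_fin, Fintype.card_fin] at this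
  rw [← this]
  refine sum_congr rfl fun P _ => ?_
  rw [Fintype.card_embedding_eq, Fintype.card_fin, Fintype.card_coe]

theorem sum_stirlingSecond_mul_descFactorial (r n : ℕ) :
    ∑ l ∈ range (n + 1), Nat.stirlingSecond r l * n.descFactorial l = n ^ r := by
  induction r with
  | zero =>
    rw [sum_range_succ', sum_eq_zero fun l _ => by rw [Nat.stirlingSecond_zero_succ, zero_mul]]
    simp
  | succ r ih =>
    have h1 : ∑ l ∈ range (n + 1), Nat.stirlingSecond (r + 1) l * n.descFactorial l =
        ∑ l ∈ range n, Nat.stirlingSecond r l * n.descFactorial (l + 1) +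
          ∑ l ∈ range n, (l + 1) * Nat.stirlingSecond r (l + 1) * n.descFactorial (l + 1) := by
      rw [sum_range_succ', Nat.stirlingSecond_succ_zero, zero_mul, add_zero, ← sum_add_distrib]
      refine sum_congr rfl fun l _ => ?_
      rw [Nat.stirlingSecond_succ_succ]
      ring
    have h2 : ∑ l ∈ range n, (l + 1) * Nat.stirlingSecond r (l + 1) * n.descFactorial (l + 1) =
        ∑ l ∈ range (n + 1), l * Nat.stirlingSecond r l * n.descFactorial l := by
      rw [sum_range_succ' _ n, zero_mul, zero_mul, add_zero]
    have h3 : ∑ l ∈ range n, Nat.stirlingSecond r l * n.descFactorial (l + 1) =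
        ∑ l ∈ range (n + 1), Nat.stirlingSecond r l * n.descFactorial (l + 1) := by
      rw [sum_range_succ, Nat.descFactorial_eq_zero_iff_lt.mpr (Nat.lt_succ_self n), mul_zero,
        add_zero]
    rw [h1, h2, h3, ← sum_add_distrib, pow_succ, ← ih, sum_mul]
    refine sum_congr rfl fun l hl => ?_
    obtain ⟨k, rfl⟩ := Nat.exists_eq_add_of_le (Nat.lt_succ_iff.mp (mem_range.mp hl))
    rw [Nat.descFactorial_succ, Nat.add_sub_cancel_left]
    ring

/-- Both families solve the same system expressing n^r in falling factorials. Taking n = 0, 1, 2, …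
it is triangular with diagonal entries n!, so the solution is unique. -/
theorem stirling_eq_stirlingSecond (r l : ℕ) : stirling r l = Nat.stirlingSecond r l := by
  induction l using Nat.strong_induction_on with
  | _ l ih =>
    have h := (sum_stirling_mul_descFactorial r l).trans
      (sum_stirlingSecond_mul_descFactorial r l).symm
    rw [sum_range_succ, sum_range_succ,
      sum_congr rfl fun k hk => by rw [ih k (mem_range.mp hk)], Nat.add_left_cancel_iff,
      Nat.descFactorial_self] at h
    exact Nat.eq_of_mul_eq_mul_right (Nat.factorial_pos l) h

theorem sum_stirling {r n : ℕ} (h : r ≤ n) :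
    ∑ l ∈ range (n + 1), stirling r l = bellNumber r := by
  have := sum_finpartition_card_parts r (N := n + 1) (fun _ => 1) fun l h1 h2 => by omega
  simp only [mul_one] at this
  rw [← this, bellNumber, sum_const, smul_eq_mul, mul_one, card_univ]

/-- The added term vanishes because S(r,0) = 0 for r > 0. -/
theorem sum_Icc_stirling_mul {R : Type*} [Semiring R] {r : ℕ} (hr : 0 < r) (n : ℕ) (g : ℕ → R) :
    ∑ l ∈ Icc 1 n, (stirling r l : R) * g l = ∑ l ∈ range (n + 1), (stirling r l : R) * g l := by
  obtain ⟨r, rfl⟩ := Nat.exists_eq_succ_of_ne_zero hr.ne'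
  refine sum_subset (fun l hl => ?_) fun l hl hl' => ?_
  · rw [mem_Icc] at hl
    exact mem_range.mpr (by omega)
  · rw [mem_range] at hl
    rw [mem_Icc] at hl'
    obtain rfl : l = 0 := by omega
    rw [stirling_eq_stirlingSecond, Nat.stirlingSecond_succ_zero, Nat.cast_zero, zero_mul]

/-! ### The values at q = 1 and q = 0 -/

theorem eval_qInt_one (i : ℕ) : (qInt i).eval 1 = i := by
  simp [qInt, Polynomial.eval_finsetSum]

theorem eval_qInt_zero {i : ℕ} (hi : i ≠ 0) : (qInt i).eval 0 = 1 := by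
  obtain ⟨i, rfl⟩ := Nat.exists_eq_succ_of_ne_zero hi
  simp [qInt, Polynomial.eval_finsetSum, sum_range_succ']

theorem eval_dPoly_one (n : ℕ) {r : ℕ} (hr : 0 < r) : (dPoly n r).eval 1 = (n : ℤ) ^ r := by
  rw [dPoly, sum_Icc_stirling_mul hr, Polynomial.eval_finsetSum, ← Nat.cast_pow,
    ← sum_stirling_mul_descFactorial r n, Nat.cast_sum]
  refine sum_congr rfl fun l _ => ?_
  rw [Polynomial.eval_mul, Polynomial.eval_natCast, Polynomial.eval_prod, Nat.cast_mul,
    Nat.descFactorial_eq_prod_range, Nat.cast_prod]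
  simp only [eval_qInt_one]

theorem eval_dPoly_zero {n r : ℕ} (hr : 0 < r) (h : r ≤ n) :
    (dPoly n r).eval 0 = (bellNumber r : ℤ) := by
  rw [dPoly, sum_Icc_stirling_mul hr, Polynomial.eval_finsetSum, ← sum_stirling h, Nat.cast_sum]
  refine sum_congr rfl fun l hl => ?_
  rw [Polynomial.eval_mul, Polynomial.eval_natCast, Polynomial.eval_prod, prod_eq_one, mul_one]
  intro i hi
  rw [mem_range] at hl hi
  exact eval_qInt_zero (by omega)

/-! ### Standard fillings and the major index by the row of the largest entry -/

/-- `g` is a standard filling of `μ`, extended by `0` outside `μ`. -/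
structure IsStandard (μ : YoungDiagram) (g : ℕ × ℕ → ℕ) : Prop where
  zero : ∀ c, c ∉ μ → g c = 0
  bijOn : Set.BijOn g μ.cells (Icc 1 μ.card)
  row : ∀ c ∈ μ, ∀ d ∈ μ, c.1 = d.1 → c.2 < d.2 → g c < g d
  col : ∀ c ∈ μ, ∀ d ∈ μ, c.2 = d.2 → c.1 < d.1 → g c < g d

open Classical in
/-- The descents of a filling. -/
noncomputable def fillDescents (μ : YoungDiagram) (g : ℕ × ℕ → ℕ) : Finset ℕ :=
  {i ∈ Icc 1 μ.card | ∃ c ∈ μ, ∃ d ∈ μ, g c = i ∧ g d = i + 1 ∧ c.1 < d.1}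

/-- The major index of a filling. -/
noncomputable def fillMaj (μ : YoungDiagram) (g : ℕ × ℕ → ℕ) : ℕ := ∑ i ∈ fillDescents μ g, i

open Classical in
/-- A standard tableau as a function on all boxes of the quadrant. -/
noncomputable def StandardTableau.toFill {n : ℕ} {μ : Shape n} (T : StandardTableau μ)
    (c : ℕ × ℕ) : ℕ :=
  if h : c ∈ μ.1.cells then (T.1 ⟨c, h⟩ : ℕ) else 0

theorem StandardTableau.toFill_of_mem {n : ℕ} {μ : Shape n} (T : StandardTableau μ) {c : ℕ × ℕ}
    (h : c ∈ μ.1.cells) : T.toFill c = T.1 ⟨c, h⟩ := dif_pos h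

theorem StandardTableau.toFill_injective {n : ℕ} (μ : Shape n) :
    Function.Injective (StandardTableau.toFill (μ := μ)) := by
  intro T T' h
  apply Subtype.ext
  ext ⟨c, hc⟩
  have := congrFun h c
  rwa [T.toFill_of_mem hc, T'.toFill_of_mem hc] at this

theorem StandardTableau.isStandard_toFill {μ : YoungDiagram}
    (T : StandardTableau (⟨μ, rfl⟩ : Shape μ.card)) : IsStandard μ T.toFill where
  zero c hc := dif_neg hc
  bijOn := by
    refine ⟨fun c hc => ?_, fun c hc d hd h => ?_, fun i hi => ?_⟩
    · rw [T.toFill_of_mem hc]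
      exact (T.1 ⟨c, hc⟩).2
    · rw [T.toFill_of_mem hc, T.toFill_of_mem hd] at h
      exact congrArg Subtype.val (T.1.injective (Subtype.ext h))
    · refine ⟨(T.1.symm ⟨i, hi⟩).1, (T.1.symm ⟨i, hi⟩).2, ?_⟩
      rw [T.toFill_of_mem (T.1.symm ⟨i, hi⟩).2]
      simp
  row c hc d hd h1 h2 := by
    rw [T.toFill_of_mem hc, T.toFill_of_mem hd]
    exact T.2.1 ⟨c, hc⟩ ⟨d, hd⟩ h1 h2
  col c hc d hd h1 h2 := by
    rw [T.toFill_of_mem hc, T.toFill_of_mem hd]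
    exact T.2.2 ⟨c, hc⟩ ⟨d, hd⟩ h1 h2

theorem IsStandard.exists_toFill {μ : YoungDiagram} {g : ℕ × ℕ → ℕ} (hg : IsStandard μ g) :
    ∃ T : StandardTableau (⟨μ, rfl⟩ : Shape μ.card), T.toFill = g := by
  have hb := Set.BijOn.bijective hg.bijOn
  refine ⟨⟨Equiv.ofBijective _ hb, ?_, ?_⟩, ?_⟩
  · exact fun c d h1 h2 => hg.row c.1 c.2 d.1 d.2 h1 h2
  · exact fun c d h1 h2 => hg.col c.1 c.2 d.1 d.2 h1 h2
  · funext c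
    by_cases hc : c ∈ μ.cells
    · exact StandardTableau.toFill_of_mem (μ := ⟨μ, rfl⟩) _ hc
    · rw [hg.zero c hc]
      exact dif_neg hc

theorem StandardTableau.fillMaj_toFill {μ : YoungDiagram}
    (T : StandardTableau (⟨μ, rfl⟩ : Shape μ.card)) : fillMaj μ T.toFill = T.maj := by
  have : fillDescents μ T.toFill = T.descents := by
    ext i
    simp only [fillDescents, StandardTableau.descents, mem_filter, and_congr_right_iff]
    intro _
    constructor
    · rintro ⟨c, hc, d, hd, h1, h2, h3⟩
      rw [T.toFill_of_mem hc] at h1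
      rw [T.toFill_of_mem hd] at h2
      exact ⟨⟨c, hc⟩, ⟨d, hd⟩, h1, h2, h3⟩
    · rintro ⟨⟨c, hc⟩, ⟨d, hd⟩, h1, h2, h3⟩
      exact ⟨c, hc, d, hd, (T.toFill_of_mem hc).trans h1, (T.toFill_of_mem hd).trans h2, h3⟩
  rw [fillMaj, this, StandardTableau.maj]

open Classical in
/-- The finite set of standard fillings of `μ`. -/
noncomputable def fillings (μ : YoungDiagram) : Finset (ℕ × ℕ → ℕ) :=
  univ.image (StandardTableau.toFill (μ := (⟨μ, rfl⟩ : Shape μ.card)))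

theorem mem_fillings {μ : YoungDiagram} {g : ℕ × ℕ → ℕ} : g ∈ fillings μ ↔ IsStandard μ g := by
  simp only [fillings, mem_image, mem_univ, true_and]
  constructor
  · rintro ⟨T, rfl⟩
    exact T.isStandard_toFill
  · exact fun h => h.exists_toFill

/-- The generating function of the major index over the standard fillings of `μ`. -/
noncomputable def majSum {R : Type*} [CommRing R] (q : R) (μ : YoungDiagram) : R :=
  ∑ g ∈ fillings μ, q ^ fillMaj μ g

theorem majSum_X {n : ℕ} (μ : Shape n) : majSum Polynomial.X μ.1 = fPoly μ := by
  classical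
  obtain ⟨μ, rfl⟩ := μ
  rw [majSum, fPoly, fillings, sum_image fun _ _ _ _ h => StandardTableau.toFill_injective _ h]
  exact sum_congr rfl fun T _ => by rw [T.fillMaj_toFill]

open Classical in
/-- The part of `majSum` from fillings whose largest entry is in row `i` or lower. -/
noncomputable def majSumGe {R : Type*} [CommRing R] (q : R) (μ : YoungDiagram) (i : ℕ) : R :=
  ∑ g ∈ fillings μ with ∃ c ∈ μ, g c = μ.card ∧ i ≤ c.1, q ^ fillMaj μ g

open Classical in
/-- The part of `majSum` from fillings whose largest entry is in row `i`. -/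
noncomputable def majSumAt {R : Type*} [CommRing R] (q : R) (μ : YoungDiagram) (i : ℕ) : R :=
  ∑ g ∈ fillings μ with ∃ c ∈ μ, g c = μ.card ∧ c.1 = i, q ^ fillMaj μ g

section Basic

variable {R : Type*} [CommRing R] (q : R) {μ ν : YoungDiagram} {i : ℕ} {g : ℕ × ℕ → ℕ}

theorem map_majSum {R' : Type*} [CommRing R'] (φ : R →+* R') (μ : YoungDiagram) :
    φ (majSum q μ) = majSum (φ q) μ := by
  simp only [majSum, map_sum, map_pow]

theorem IsStandard.le_card (hg : IsStandard μ g) (c : ℕ × ℕ) : g c ≤ μ.card := by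
  by_cases hc : c ∈ μ
  · exact (mem_Icc.mp (hg.bijOn.mapsTo hc)).2
  · rw [hg.zero c hc]
    exact Nat.zero_le _

theorem IsStandard.eq_of_eq (hg : IsStandard μ g) {c d : ℕ × ℕ} (hc : c ∈ μ) (hd : d ∈ μ)
    (h : g c = g d) : c = d := hg.bijOn.injOn hc hd h

theorem IsStandard.exists_eq (hg : IsStandard μ g) {k : ℕ} (h1 : 1 ≤ k) (h2 : k ≤ μ.card) :
    ∃ c ∈ μ, g c = k := hg.bijOn.surjOn (mem_coe.mpr (mem_Icc.mpr ⟨h1, h2⟩))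

theorem majSumGe_zero (h : 0 < μ.card) : majSumGe q μ 0 = majSum q μ := by
  classical
  rw [majSumGe, majSum, filter_true_of_mem]
  intro g hg
  obtain ⟨c, hc, h'⟩ := (mem_fillings.mp hg).exists_eq h le_rfl
  exact ⟨c, hc, h', Nat.zero_le _⟩

theorem majSumGe_eq_zero (h : μ.rowLen i = 0) : majSumGe q μ i = 0 := by
  classical
  rw [majSumGe, filter_false_of_mem, sum_empty]
  rintro g - ⟨⟨a, b⟩, hc, -, h'⟩
  have h1 := YoungDiagram.mem_iff_lt_rowLen.mp hc
  have h2 := μ.rowLen_anti i a h'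
  omega

theorem majSumGe_eq_add : majSumGe q μ i = majSumAt q μ i + majSumGe q μ (i + 1) := by
  classical
  rw [majSumGe, majSumAt, majSumGe, ← sum_union]
  · refine sum_congr ?_ fun _ _ => rfl
    rw [← filter_or]
    refine filter_congr fun g _ => ?_
    constructor
    · rintro ⟨c, hc, h, hi⟩
      rcases hi.eq_or_lt with h' | h'
      · exact Or.inl ⟨c, hc, h, h'.symm⟩
      · exact Or.inr ⟨c, hc, h, h'⟩
    · rintro (⟨c, hc, h, hi⟩ | ⟨c, hc, h, hi⟩)
      · exact ⟨c, hc, h, hi.ge⟩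
      · exact ⟨c, hc, h, (Nat.le_succ i).trans hi⟩
  · refine disjoint_filter.mpr ?_
    rintro g hg ⟨c, hc, h, hi⟩ ⟨d, hd, h', hi'⟩
    obtain rfl := (mem_fillings.mp hg).eq_of_eq hc hd (h.trans h'.symm)
    omega

theorem exists_addAt_of_lt (h : μ.rowLen (i + 1) < μ.rowLen i) : ∃ κ, AddAt i κ μ := by
  obtain ⟨κ, hκ⟩ := exists_rowLen_eq (fun j => μ.rowLen j - if j = i then 1 else 0)
    (antitone_nat_of_succ_le fun j => by
      have := μ.rowLen_anti j (j + 1) (Nat.le_succ j)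
      rcases eq_or_ne j i with rfl | hj
      · rw [if_neg (by omega), if_pos rfl]
        omega
      · rw [if_neg hj]
        omega)
    (N := μ.card) fun j hj => by rw [rowLen_eq_zero hj, Nat.zero_sub]
  refine ⟨κ, fun j => ?_⟩
  rw [hκ j]
  split_ifs with hj
  · subst hj
    omega
  · rfl

/-- The box with the largest entry is the last one in its row and its column. -/
theorem IsStandard.rowLen_of_eq_card (hg : IsStandard μ g) {c : ℕ × ℕ} (hc : c ∈ μ)
    (h : g c = μ.card) : μ.rowLen c.1 = c.2 + 1 ∧ μ.rowLen (c.1 + 1) ≤ c.2 := by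
  obtain ⟨a, b⟩ := c
  constructor
  · refine le_antisymm ?_ (YoungDiagram.mem_iff_lt_rowLen.mp hc)
    by_contra! hlt
    have hd : (a, b + 1) ∈ μ := YoungDiagram.mem_iff_lt_rowLen.mpr hlt
    have h1 := hg.row _ hc _ hd rfl (Nat.lt_succ_self b)
    have h2 := hg.le_card (a, b + 1)
    omega
  · by_contra! hlt
    have hd : (a + 1, b) ∈ μ := YoungDiagram.mem_iff_lt_rowLen.mpr hlt
    have h1 := hg.col _ hc _ hd rfl (Nat.lt_succ_self a)
    have h2 := hg.le_card (a + 1, b)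
    omega

theorem majSumAt_eq_zero (h : ¬ ∃ κ, AddAt i κ μ) : majSumAt q μ i = 0 := by
  classical
  rw [majSumAt, filter_false_of_mem, sum_empty]
  rintro g hg ⟨c, hc, h', rfl⟩
  have := (mem_fillings.mp hg).rowLen_of_eq_card hc h'
  exact h (exists_addAt_of_lt (by omega))

end Basic

/-! ### Inserting and deleting the largest entry -/

section AddAt

variable {μ ν : YoungDiagram} {i : ℕ} {g : ℕ × ℕ → ℕ}

theorem AddAt.mem_iff (h : AddAt i ν μ) {c : ℕ × ℕ} : c ∈ μ ↔ c ∈ ν ∨ c = (i, ν.rowLen i) := by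
  obtain ⟨a, b⟩ := c
  rw [YoungDiagram.mem_iff_lt_rowLen, YoungDiagram.mem_iff_lt_rowLen, h a, Prod.mk.injEq]
  split_ifs with ha
  · subst ha
    omega
  · omega

theorem box_notMem (ν : YoungDiagram) (i : ℕ) : (i, ν.rowLen i) ∉ ν := fun h =>
  lt_irrefl _ (YoungDiagram.mem_iff_lt_rowLen.mp h)

theorem AddAt.cells_eq (h : AddAt i ν μ) :
    (μ.cells : Set (ℕ × ℕ)) = insert (i, ν.rowLen i) (ν.cells : Set (ℕ × ℕ)) := by
  ext c
  simp only [mem_coe, YoungDiagram.mem_cells, Set.mem_insert_iff, h.mem_iff, or_comm]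

theorem coe_Icc_succ (m : ℕ) : ((Icc 1 (m + 1) : Finset ℕ) : Set ℕ) =
    insert (m + 1) ((Icc 1 m : Finset ℕ) : Set ℕ) := by
  ext k
  simp only [coe_Icc, Set.mem_Icc, Set.mem_insert_iff]
  omega

/-- Fillings are total functions vanishing off their shape, so passing between shapes is a single
`Function.update`, undone by `IsStandard.update_zero`. -/
theorem IsStandard.update (hg : IsStandard ν g) (h : AddAt i ν μ) :
    IsStandard μ (Function.update g (i, ν.rowLen i) (ν.card + 1)) := by
  have hne : ∀ c ∈ ν, c ≠ (i, ν.rowLen i) := fun c hc he => box_notMem ν i (he ▸ hc)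
  refine ⟨fun c hc => ?_, ?_, fun c hc d hd h1 h2 => ?_, fun c hc d hd h1 h2 => ?_⟩
  · rw [h.mem_iff, not_or] at hc
    rw [Function.update_of_ne hc.2, hg.zero c hc.1]
  · rw [h.cells_eq, h.card, coe_Icc_succ]
    have h1 : Set.BijOn (Function.update g (i, ν.rowLen i) (ν.card + 1)) ν.cells
        (Icc 1 ν.card : Finset ℕ) :=
      hg.bijOn.congr fun c hc => (Function.update_of_ne (hne c hc) _ _).symm
    have h2 := h1.insert (a := (i, ν.rowLen i))
    rw [Function.update_self] at h2
    refine h2 fun hmem => ?_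
    simp at hmem
  · rcases h.mem_iff.mp hc with hc | rfl
    · rw [Function.update_of_ne (hne c hc)]
      rcases h.mem_iff.mp hd with hd | rfl
      · rw [Function.update_of_ne (hne d hd)]
        exact hg.row c hc d hd h1 h2
      · rw [Function.update_self]
        exact Nat.lt_succ_of_le (hg.le_card c)
    · have h3 := YoungDiagram.mem_iff_lt_rowLen.mp (show (d.1, d.2) ∈ μ from hd)
      rw [← h1, h i, if_pos rfl] at h3
      simp only at h2
      omega
  · rcases h.mem_iff.mp hc with hc | rfl
    · rw [Function.update_of_ne (hne c hc)]
      rcases h.mem_iff.mp hd with hd | rfl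
      · rw [Function.update_of_ne (hne d hd)]
        exact hg.col c hc d hd h1 h2
      · rw [Function.update_self]
        exact Nat.lt_succ_of_le (hg.le_card c)
    · have h3 := YoungDiagram.mem_iff_lt_rowLen.mp (show (d.1, d.2) ∈ μ from hd)
      simp only at h1 h2
      have h4 := ν.rowLen_anti _ _ h2.le
      rw [← h1, h d.1, if_neg h2.ne'] at h3
      omega

theorem IsStandard.update_zero (hg : IsStandard μ g) (h : AddAt i ν μ)
    (hc : g (i, ν.rowLen i) = μ.card) :
    IsStandard ν (Function.update g (i, ν.rowLen i) 0) := by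
  have hne : ∀ c ∈ ν, c ≠ (i, ν.rowLen i) := fun c hc he => box_notMem ν i (he ▸ hc)
  have hle := h.le
  refine ⟨fun c hc => ?_, ?_, fun c hc d hd h1 h2 => ?_, fun c hc d hd h1 h2 => ?_⟩
  · by_cases hc' : c = (i, ν.rowLen i)
    · rw [hc', Function.update_self]
    · rw [Function.update_of_ne hc']
      exact hg.zero c fun hm => (h.mem_iff.mp hm).elim hc hc'
  · have h1 := hg.bijOn.sdiff_singleton (a := (i, ν.rowLen i)) (h.mem_iff.mpr (Or.inr rfl))
    rw [hc, h.card, coe_Icc_succ, h.cells_eq, Set.insert_sdiff_self_of_notMem,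
      Set.insert_sdiff_self_of_notMem] at h1
    · exact h1.congr fun c hc => (Function.update_of_ne (hne c hc) _ _).symm
    · simp
    · exact box_notMem ν i
  · rw [Function.update_of_ne (hne c hc), Function.update_of_ne (hne d hd)]
    exact hg.row c (hle hc) d (hle hd) h1 h2
  · rw [Function.update_of_ne (hne c hc), Function.update_of_ne (hne d hd)]
    exact hg.col c (hle hc) d (hle hd) h1 h2

-- The only possible new descent is at |ν|, and it occurs exactly when the old largest entry lies
-- above the new box.
open Classical in
theorem IsStandard.fillMaj_update (hg : IsStandard ν g) (h : AddAt i ν μ) :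
    fillMaj μ (Function.update g (i, ν.rowLen i) (ν.card + 1)) =
      fillMaj ν g + if ∃ c ∈ ν, g c = ν.card ∧ c.1 < i then ν.card else 0 := by
  have hne : ∀ c ∈ ν, c ≠ (i, ν.rowLen i) := fun c hc he => box_notMem ν i (he ▸ hc)
  set g' := Function.update g (i, ν.rowLen i) (ν.card + 1) with hg'
  have hold : ∀ c ∈ ν, g' c = g c := fun c hc => Function.update_of_ne (hne c hc) _ _
  have hnew : g' (i, ν.rowLen i) = ν.card + 1 := Function.update_self ..
  have hstd : IsStandard μ g' := hg.update h
  have hbox : (i, ν.rowLen i) ∈ μ := h.mem_iff.mpr (Or.inr rfl)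
  have hmem : ∀ k, k ∈ fillDescents μ g' ↔ k ∈ fillDescents ν g ∨
      (k = ν.card ∧ ∃ c ∈ ν, g c = ν.card ∧ c.1 < i) := by
    intro k
    simp only [fillDescents, mem_filter, mem_Icc]
    constructor
    · rintro ⟨⟨hk1, hk2⟩, c, hc, d, hd, h1, h2, h3⟩
      have hle := hstd.le_card d
      rw [h.card] at hle
      rcases h.mem_iff.mp hc with hc | rfl
      · rw [hold c hc] at h1
        rcases h.mem_iff.mp hd with hd | rfl
        · rw [hold d hd] at h2
          have := hg.le_card d
          exact Or.inl ⟨⟨hk1, by omega⟩, c, hc, d, hd, h1, h2, h3⟩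
        · rw [hnew] at h2
          obtain rfl : k = ν.card := by omega
          exact Or.inr ⟨rfl, c, hc, h1, h3⟩
      · rw [hnew] at h1
        omega
    · rintro (⟨⟨hk1, hk2⟩, c, hc, d, hd, h1, h2, h3⟩ | ⟨rfl, c, hc, h1, h3⟩)
      · exact ⟨⟨hk1, by rw [h.card]; omega⟩, c, h.le hc, d, h.le hd, (hold c hc).trans h1,
          (hold d hd).trans h2, h3⟩
      · have := mem_Icc.mp (mem_coe.mp (hg.bijOn.mapsTo hc))
        exact ⟨⟨by omega, by rw [h.card]; omega⟩, c, h.le hc, _, hbox, (hold c hc).trans h1, hnew,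
          h3⟩
  rw [fillMaj, fillMaj]
  split_ifs with hd
  · have hnot : ν.card ∉ fillDescents ν g := by
      simp only [fillDescents, mem_filter, not_and]
      rintro - ⟨c, hc, d, hd, h1, h2, h3⟩
      have := hg.le_card d
      omega
    have : fillDescents μ g' = insert ν.card (fillDescents ν g) := by
      ext k
      rw [hmem, mem_insert, or_comm, and_iff_left hd]
    rw [this, sum_insert hnot, add_comm]
  · have : fillDescents μ g' = fillDescents ν g := by
      ext k
      rw [hmem, or_iff_left fun h => hd h.2]
    rw [this, add_zero]

/-- Deleting the largest entry is a bijection onto fillings of ν. It costs a factor q^{|ν|} unless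
the next largest entry lies in row i or lower, and the second term corrects for those fillings. -/
theorem majSumAt_of_addAt {R : Type*} [CommRing R] (q : R) (h : AddAt i ν μ) :
    majSumAt q μ i = q ^ ν.card * majSum q ν + (1 - q ^ ν.card) * majSumGe q ν i := by
  classical
  have hbox : (i, ν.rowLen i) ∈ μ := h.mem_iff.mpr (Or.inr rfl)
  have hlast : ∀ g, IsStandard μ g → (∃ c ∈ μ, g c = μ.card ∧ c.1 = i) →
      g (i, ν.rowLen i) = μ.card := by
    rintro g hg ⟨⟨a, b⟩, hc, h1, rfl⟩
    have h2 := (hg.rowLen_of_eq_card hc h1).1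
    simp only at h2
    rw [h a, if_pos rfl, Nat.add_right_cancel_iff] at h2
    rw [h2]
    exact h1
  have h1 : majSumAt q μ i = ∑ g ∈ fillings ν,
      q ^ (fillMaj ν g + if ∃ c ∈ ν, g c = ν.card ∧ c.1 < i then ν.card else 0) := by
    rw [majSumAt]
    symm
    refine sum_bij' (fun g _ => Function.update g (i, ν.rowLen i) (ν.card + 1))
      (fun g _ => Function.update g (i, ν.rowLen i) 0) ?_ ?_ ?_ ?_ ?_
    · intro g hg
      refine mem_filter.mpr ⟨mem_fillings.mpr ((mem_fillings.mp hg).update h), _, hbox, ?_, rfl⟩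
      rw [Function.update_self, h.card]
    · intro g hg
      rw [mem_filter, mem_fillings] at hg
      exact mem_fillings.mpr (hg.1.update_zero h (hlast g hg.1 hg.2))
    · intro g hg
      rw [Function.update_idem, ← (mem_fillings.mp hg).zero _ (box_notMem ν i),
        Function.update_eq_self]
    · intro g hg
      rw [mem_filter, mem_fillings] at hg
      rw [Function.update_idem, ← h.card, ← hlast g hg.1 hg.2, Function.update_eq_self]
    · intro g hg
      rw [(mem_fillings.mp hg).fillMaj_update h]
  rw [h1, majSum, majSumGe, sum_filter, mul_sum, mul_sum, ← sum_add_distrib]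
  refine sum_congr rfl fun g hg => ?_
  rcases Nat.eq_zero_or_pos ν.card with h0 | hpos
  -- The empty diagram has no largest entry, but there q^{|ν|} = 1 and the correction vanishes.
  · simp [h0]
  · obtain ⟨c, hc, hgc⟩ := (mem_fillings.mp hg).exists_eq hpos le_rfl
    have hiff : ∀ p : ℕ → Prop, (∃ c ∈ ν, g c = ν.card ∧ p c.1) ↔ p c.1 := by
      intro p
      constructor
      · rintro ⟨d, hd, hgd, hp⟩
        rwa [(mem_fillings.mp hg).eq_of_eq hc hd (hgc.trans hgd.symm)]
      · exact fun hp => ⟨c, hc, hgc, hp⟩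
    rw [if_congr (hiff (· < i)) rfl rfl, if_congr (hiff (i ≤ ·)) rfl rfl]
    rcases lt_or_ge c.1 i with hlt | hge
    · rw [if_pos hlt, if_neg (not_le.mpr hlt)]
      ring
    · rw [if_neg (not_lt.mpr hge), if_pos hge]
      ring

end AddAt

/-! ### The principal specialization and its Pieri rule -/

section Recursion

variable {K : Type*} [Field K] (q : K)

/-- `(1 - q)(1 - q²)⋯(1 - qᵐ)`. -/
def qPoch (m : ℕ) : K := ∏ j ∈ range m, (1 - q ^ (j + 1))

/-- The principal specialization: `majSum` divided by `(1 - q)⋯(1 - qⁿ)`. -/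
noncomputable def spec (μ : YoungDiagram) : K := majSum q μ / qPoch q μ.card

open Classical in
/-- The part of the sum over nonempty horizontal strips coming from the strips with no box above
row `i`. -/
noncomputable def stripSumGe (μ : YoungDiagram) (i : ℕ) : K :=
  ∑ ν ∈ strips μ with ν ≠ μ ∧ ∀ j < i, ν.rowLen j = μ.rowLen j, q ^ ν.card * spec q ν

variable {q}

theorem qPoch_ne_zero (hq : ∀ j, q ^ (j + 1) ≠ 1) (m : ℕ) : qPoch q m ≠ 0 :=
  prod_ne_zero_iff.mpr fun j _ => sub_ne_zero.mpr (hq j).symm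

theorem qPoch_succ (m : ℕ) : qPoch q (m + 1) = qPoch q m * (1 - q ^ (m + 1)) :=
  prod_range_succ _ _

theorem spec_mul_qPoch (hq : ∀ j, q ^ (j + 1) ≠ 1) (μ : YoungDiagram) :
    qPoch q μ.card * spec q μ = majSum q μ :=
  mul_div_cancel₀ _ (qPoch_ne_zero hq _)

theorem stripSumGe_eq_zero {μ : YoungDiagram} {i : ℕ} (h : μ.card ≤ i) : stripSumGe q μ i = 0 := by
  classical
  rw [stripSumGe, filter_false_of_mem, sum_empty]
  rintro ν hν ⟨hne, hj⟩
  rw [mem_strips] at hν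
  refine hne (ext_rowLen fun j => ?_)
  by_cases hji : j < i
  · exact hj j hji
  · have h1 := rowLen_eq_zero (h.trans (not_lt.mp hji))
    have h2 := (hν j).1
    omega

/-- A strip with no box above row i either takes a box from row i, and is then κ or a strip removed
from κ, or starts below row i. -/
theorem stripSumGe_of_addAt {μ κ : YoungDiagram} {i : ℕ} (h : AddAt i κ μ) :
    stripSumGe q μ i =
      q ^ κ.card * spec q κ + stripSumGe q κ i + stripSumGe q μ (i + 1) := by
  classical
  have hκ : κ ∈ (strips κ).filter fun ν => ∀ j < i, ν.rowLen j = κ.rowLen j :=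
    mem_filter.mpr ⟨mem_strips.mpr (HStrip.refl κ), fun _ _ => rfl⟩
  have h1 : q ^ κ.card * spec q κ + stripSumGe q κ i =
      ∑ ν ∈ strips κ with ∀ j < i, ν.rowLen j = κ.rowLen j, q ^ ν.card * spec q ν := by
    rw [← add_sum_erase _ _ hκ, stripSumGe]
    congr 1
    refine sum_congr (Finset.ext fun ν => ?_) fun _ _ => rfl
    rw [mem_erase, mem_filter, mem_filter]
    tauto
  rw [h1, stripSumGe, stripSumGe, ← sum_union]
  · refine sum_congr (Finset.ext fun ν => ?_) fun _ _ => rfl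
    rw [mem_union, mem_filter, mem_filter, mem_filter, mem_strips, mem_strips]
    constructor
    · rintro ⟨hs, hne, hj⟩
      by_cases hi : ν.rowLen i = μ.rowLen i
      · refine Or.inr ⟨hs, hne, fun j hji => ?_⟩
        rcases (Nat.lt_succ_iff_lt_or_eq.mp hji) with hlt | rfl
        · exact hj j hlt
        · exact hi
      · refine Or.inl ⟨fun j => ?_, fun j hji => ?_⟩
        · have h2 := hs j
          have h3 := h j
          have h4 := h (j + 1)
          refine ⟨?_, by omega⟩
          split_ifs at h3 with hji
          · subst hji
            omega
          · omega
        · rw [hj j hji, h j, if_neg hji.ne, add_zero]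
    · rintro (⟨hs, hj⟩ | ⟨hs, hne, hj⟩)
      · have hi : ν.rowLen i < μ.rowLen i := by
          rw [h i, if_pos rfl]
          exact Nat.lt_succ_of_le (hs i).1
        refine ⟨fun j => ?_, fun he => hi.ne (he ▸ rfl), fun j hji => ?_⟩
        · have h2 := hs j
          have h3 := h j
          have h4 := h (j + 1)
          refine ⟨by omega, ?_⟩
          split_ifs at h4 with hji
          · have h5 := hj j (by omega)
            have h6 := μ.rowLen_anti j (j + 1) (Nat.le_succ j)
            rw [if_neg (by omega)] at h3
            omega
          · omega
        · rw [hj j hji, h j, if_neg hji.ne, add_zero]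
      · exact ⟨hs, hne, fun j hji => hj j (hji.trans (Nat.lt_succ_self i))⟩
  · rw [Finset.disjoint_left]
    intro ν hν hν'
    rw [mem_filter, mem_strips] at hν hν'
    have h2 := (hν.1 i).1
    have h3 := hν'.2.2 i (Nat.lt_succ_self i)
    have h4 := h i
    rw [if_pos rfl] at h4
    omega

/-- Without a corner in row i, rows i and i + 1 have equal length, and interlacing fixes row i of ν.
-/
theorem stripSumGe_of_not_exists {μ : YoungDiagram} {i : ℕ} (h : ¬ ∃ κ, AddAt i κ μ) :
    stripSumGe q μ i = stripSumGe q μ (i + 1) := by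
  classical
  refine sum_congr (Finset.ext fun ν => ?_) fun _ _ => rfl
  simp only [mem_filter, mem_strips, and_congr_right_iff]
  intro hs _
  have hi : ν.rowLen i = μ.rowLen i := by
    refine (hs i).1.antisymm ?_
    by_contra! hlt
    exact h (exists_addAt_of_lt ((hs i).2.trans_lt hlt))
  constructor
  · intro hj j hji
    rcases (Nat.lt_succ_iff_lt_or_eq.mp hji) with hlt | rfl
    · exact hj j hlt
    · exact hi
  · exact fun hj j hji => hj j (hji.trans (Nat.lt_succ_self i))

/-- Both sides obey the same recursion: peel off row i, and delete its corner if there is one. Hence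
the induction on |μ|, with an inner descending induction on i starting from |μ|, where both sides
vanish. -/
theorem majSumGe_eq_stripSumGe (hq : ∀ j, q ^ (j + 1) ≠ 1) (μ : YoungDiagram) (i : ℕ) :
    majSumGe q μ i = qPoch q (μ.card - 1) * stripSumGe q μ i := by
  induction hn : μ.card using Nat.strong_induction_on generalizing μ i with
  | _ n ih =>
    subst hn
    rcases le_total μ.card i with hi | hi
    · rw [majSumGe_eq_zero q (rowLen_eq_zero hi), stripSumGe_eq_zero hi, mul_zero]
    · induction hi using Nat.decreasingInduction with
      | self => rw [majSumGe_eq_zero q (rowLen_eq_zero le_rfl), stripSumGe_eq_zero le_rfl, mul_zero]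
      | of_succ i hi ihi =>
        rw [majSumGe_eq_add, ihi]
        by_cases h : ∃ κ, AddAt i κ μ
        · obtain ⟨κ, h⟩ := h
          -- The factor 1 - q^{|κ|} completes the product up to |κ| - 1 into the one up to |κ|. For
          -- empty κ both sides are 0, so the truncated subtraction does no harm.
          have hrec : (1 - q ^ κ.card) * majSumGe q κ i = qPoch q κ.card * stripSumGe q κ i := by
            rw [ih κ.card (by rw [h.card]; exact Nat.lt_succ_self _) κ i rfl]
            rcases Nat.eq_zero_or_pos κ.card with h0 | hpos
            · rw [stripSumGe_eq_zero (by omega), mul_zero, mul_zero, mul_zero]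
            · obtain ⟨m, hm⟩ := Nat.exists_eq_succ_of_ne_zero hpos.ne'
              rw [hm, Nat.succ_eq_add_one, qPoch_succ, Nat.add_sub_cancel]
              ring
          rw [majSumAt_of_addAt q h, hrec, stripSumGe_of_addAt h, h.card, Nat.add_sub_cancel,
            ← spec_mul_qPoch hq κ]
          ring
        · rw [majSumAt_eq_zero q h, stripSumGe_of_not_exists h, zero_add]

/-- At i = 0 the preceding identity reads (1 - q^n) s_μ = sum over nonempty strips, with n = |μ| >
0; the empty strip supplies the missing q^n s_μ. -/
theorem spec_eq_sum_strips (hq : ∀ j, q ^ (j + 1) ≠ 1) (μ : YoungDiagram) :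
    spec q μ = ∑ ν ∈ strips μ, q ^ ν.card * spec q ν := by
  classical
  have hmem : μ ∈ strips μ := mem_strips.mpr (HStrip.refl μ)
  have h0 : ∑ ν ∈ (strips μ).erase μ, q ^ ν.card * spec q ν = stripSumGe q μ 0 := by
    refine sum_congr (Finset.ext fun ν => ?_) fun _ _ => rfl
    simp [mem_erase, and_comm]
  rw [← add_sum_erase _ _ hmem, h0]
  rcases Nat.eq_zero_or_pos μ.card with hz | hpos
  · rw [stripSumGe_eq_zero hz.le, hz, pow_zero, one_mul, add_zero]
  · have h1 := majSumGe_eq_stripSumGe hq μ 0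
    rw [majSumGe_zero q hpos, ← spec_mul_qPoch hq μ] at h1
    obtain ⟨m, hm⟩ := Nat.exists_eq_succ_of_ne_zero hpos.ne'
    rw [hm, Nat.succ_eq_add_one, Nat.add_sub_cancel, qPoch_succ, mul_assoc] at h1
    have h2 := mul_left_cancel₀ (qPoch_ne_zero hq m) h1
    rw [hm, Nat.succ_eq_add_one]
    linear_combination h2

theorem sum_above_majSum_of_field (hq : ∀ j, q ^ (j + 1) ≠ 1) (μ : YoungDiagram) :
    ∑ l ∈ above μ, majSum q l = (∑ k ∈ range (μ.card + 1), q ^ k) * majSum q μ := by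
  have h := sum_above_of_sum_strips hq (spec_eq_sum_strips hq) μ
  have h1 : ∑ l ∈ above μ, majSum q l = qPoch q (μ.card + 1) * ∑ l ∈ above μ, spec q l := by
    rw [mul_sum]
    refine sum_congr rfl fun l hl => ?_
    rw [← spec_mul_qPoch hq l, (mem_above.mp hl).2]
  have h2 := mul_neg_geom_sum q (μ.card + 1)
  have h3 : 1 - q ≠ 0 := sub_ne_zero.mpr (by simpa using (hq 0).symm)
  apply mul_left_cancel₀ h3
  rw [h1, ← spec_mul_qPoch hq μ, qPoch_succ, ← h, ← h2]
  ring

end Recursion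

open Polynomial in
/-- Summing the major index generating function over the ways to add a box. -/
theorem sum_above_majSum (μ : YoungDiagram) :
    ∑ l ∈ above μ, majSum (X : ℤ[X]) l = qInt (μ.card + 1) * majSum X μ := by
  -- The division by (1-q)⋯(1-q^n) takes place in the fraction field, where X is not a root of
  -- unity.
  apply IsFractionRing.injective ℤ[X] (FractionRing ℤ[X])
  have hq : ∀ j, (algebraMap ℤ[X] (FractionRing ℤ[X]) X) ^ (j + 1) ≠ 1 := by
    intro j h
    rw [← map_pow, ← map_one (algebraMap ℤ[X] (FractionRing ℤ[X]))] at h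
    have h' := congrArg natDegree (IsFractionRing.injective ℤ[X] (FractionRing ℤ[X]) h)
    rw [natDegree_X_pow, natDegree_one] at h'
    omega
  rw [map_sum, map_mul, qInt, map_sum]
  simp only [map_majSum, map_pow]
  exact sum_above_majSum_of_field hq μ

/-! ### The one-row diagram -/

theorem rowLen_oneRow (n j : ℕ) : (oneRow n).1.rowLen j = if j = 0 then n else 0 := by
  refine eq_of_forall_lt_iff fun k => ?_
  rw [← YoungDiagram.mem_iff_lt_rowLen]
  change (j, k) ∈ ({0} ×ˢ range n : Finset (ℕ × ℕ)) ↔ _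
  rw [mem_product, mem_singleton, mem_range]
  split_ifs with hj <;> simp [hj]

theorem addAt_oneRow (n : ℕ) : AddAt 0 (oneRow n).1 (oneRow (n + 1)).1 := by
  intro j
  rw [rowLen_oneRow, rowLen_oneRow]
  split_ifs <;> rfl

theorem majSum_of_card_eq_zero {R : Type*} [CommRing R] (q : R) {μ : YoungDiagram}
    (h : μ.card = 0) : majSum q μ = 1 := by
  have hnot : ∀ c, c ∉ μ := by
    intro c hc
    have := card_eq_zero.mp h
    rw [← YoungDiagram.mem_cells, this] at hc
    exact absurd hc (notMem_empty c)
  have hempty : μ.cells = ∅ := card_eq_zero.mp h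
  have : fillings μ = {fun _ => 0} := by
    ext g
    rw [mem_fillings, mem_singleton]
    constructor
    · exact fun hg => funext fun c => hg.zero c (hnot c)
    · rintro rfl
      refine ⟨fun _ _ => rfl, ?_, fun c hc => absurd hc (hnot c), fun c hc => absurd hc (hnot c)⟩
      rw [h, hempty]
      simp
  rw [majSum, this, sum_singleton, fillMaj, fillDescents, h]
  simp

theorem majSum_oneRow {R : Type*} [CommRing R] (q : R) (n : ℕ) : majSum q (oneRow n).1 = 1 := by
  induction n with
  | zero => exact majSum_of_card_eq_zero q (oneRow 0).2
  | succ n ih =>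
    have hpos : 0 < (oneRow (n + 1)).1.card := by
      rw [(oneRow (n + 1)).2]
      exact Nat.succ_pos n
    rw [← majSumGe_zero q hpos, majSumGe_eq_add, majSumAt_of_addAt q (addAt_oneRow n),
      majSumGe_eq_zero q (i := 0 + 1) (by rw [rowLen_oneRow, if_neg (by omega)]), ih,
      (oneRow n).2]
    rcases Nat.eq_zero_or_pos n with rfl | hn
    · simp
    · rw [majSumGe_zero q (by rwa [(oneRow n).2]), ih]
      ring

/-! ### Up and down operators and normal ordering -/

/-- The up operator of Young's lattice. -/
noncomputable def upOp : Module.End ℕ (YoungDiagram → ℕ) where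
  toFun φ μ := ∑ ν ∈ below μ, φ ν
  map_add' _ _ := funext fun _ => sum_add_distrib
  map_smul' _ _ := funext fun _ => (mul_sum _ _ _).symm

/-- The down operator of Young's lattice. -/
noncomputable def downOp : Module.End ℕ (YoungDiagram → ℕ) where
  toFun φ μ := ∑ ν ∈ above μ, φ ν
  map_add' _ _ := funext fun _ => sum_add_distrib
  map_smul' _ _ := funext fun _ => (mul_sum _ _ _).symm

open Classical in
/-- The indicator function of the one-row diagram. -/
noncomputable def rowInd (n : ℕ) (μ : YoungDiagram) : ℕ := if μ = (oneRow n).1 then 1 else 0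

theorem upOp_apply (φ : YoungDiagram → ℕ) (μ : YoungDiagram) :
    upOp φ μ = ∑ ν ∈ below μ, φ ν := rfl

theorem downOp_apply (φ : YoungDiagram → ℕ) (μ : YoungDiagram) :
    downOp φ μ = ∑ ν ∈ above μ, φ ν := rfl

theorem downOp_mul_upOp : downOp * upOp = upOp * downOp + 1 :=
  LinearMap.ext fun φ => funext fun μ => sum_above_sum_below φ μ

/-- Moving D to the right past each of the ℓ factors U leaves one commutator term U^ℓ. -/
theorem upOp_mul_downOp_mul_pow (l : ℕ) :
    upOp * downOp * upOp ^ l = upOp ^ (l + 1) * downOp + l • upOp ^ l := by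
  induction l with
  | zero => simp
  | succ l ih =>
    calc upOp * downOp * upOp ^ (l + 1) = upOp * (downOp * upOp) * upOp ^ l := by
          rw [pow_succ']; simp only [mul_assoc]
      _ = upOp * (upOp * downOp * upOp ^ l) + upOp ^ (l + 1) := by
          rw [downOp_mul_upOp, pow_succ' upOp l]; simp only [mul_add, add_mul, mul_assoc, mul_one]
      _ = upOp ^ (l + 1 + 1) * downOp + (l + 1) • upOp ^ (l + 1) := by
          rw [ih, mul_add, ← mul_assoc, ← pow_succ', mul_smul_comm, ← pow_succ', add_assoc,
            succ_nsmul]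

theorem addBox_oneRow_iff {n : ℕ} {μ : YoungDiagram} :
    AddBox μ (oneRow (n + 1)).1 ↔ μ = (oneRow n).1 := by
  constructor
  · intro h
    obtain ⟨i, hi⟩ := h.exists_addAt
    have h1 := hi i
    rw [rowLen_oneRow, if_pos rfl] at h1
    obtain rfl : i = 0 := by
      by_contra hne
      rw [if_neg hne] at h1
      omega
    exact hi.left_unique (addAt_oneRow n)
  · rintro rfl
    exact (addAt_oneRow n).addBox

theorem downOp_rowInd_succ (n : ℕ) : downOp (rowInd (n + 1)) = rowInd n := by
  classical
  funext μ
  simp only [downOp_apply, rowInd, sum_ite_eq', mem_above, addBox_oneRow_iff]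

theorem downOp_rowInd_zero : downOp (rowInd 0) = 0 := by
  classical
  funext μ
  rw [downOp_apply]
  refine sum_eq_zero fun ν hν => if_neg ?_
  rintro rfl
  have := (mem_above.mp hν).2
  rw [(oneRow 0).2] at this
  omega

/-- Normal ordering of `(U D)^r`, applied to the one-row diagram. -/
theorem upOp_mul_downOp_pow_rowInd (n r : ℕ) : ((upOp * downOp) ^ r) (rowInd n) =
    ∑ l ∈ range (n + 1), stirling r l • (upOp ^ l) (rowInd (n - l)) := by
  simp only [stirling_eq_stirlingSecond]
  induction r with
  | zero =>
    rw [sum_range_succ', sum_eq_zero fun l _ => by rw [Nat.stirlingSecond_zero_succ, zero_smul]]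
    simp
  | succ r ih =>
    have h1 : ∀ l, (upOp * downOp) ((upOp ^ l) (rowInd (n - l))) =
        (upOp ^ (l + 1)) (downOp (rowInd (n - l))) + l • (upOp ^ l) (rowInd (n - l)) := by
      intro l
      have := LinearMap.congr_fun (upOp_mul_downOp_mul_pow l) (rowInd (n - l))
      exact this
    rw [pow_succ', Module.End.mul_apply, ih, map_sum]
    simp only [map_nsmul, h1, smul_add]
    -- The term ℓ = n of the first sum vanishes because D kills the empty diagram, and ℓ = 0 of the
    -- second because of its coefficient. After the shift, the Stirling recurrence applies term by
    -- term.
    rw [sum_add_distrib, sum_range_succ, Nat.sub_self, downOp_rowInd_zero, map_zero, smul_zero,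
      add_zero, sum_range_succ' _ n, zero_smul, smul_zero, add_zero, ← sum_add_distrib,
      sum_range_succ' _ n, Nat.stirlingSecond_succ_zero, zero_smul, add_zero]
    refine sum_congr rfl fun l hl => ?_
    obtain ⟨k, hk⟩ : ∃ k, n - l = k + 1 := ⟨n - l - 1, by rw [mem_range] at hl; omega⟩
    rw [hk, downOp_rowInd_succ, show n - (l + 1) = k by omega, Nat.stirlingSecond_succ_succ,
      smul_smul, ← add_smul, mul_comm, add_comm]

/-! ### Pairing with the major index generating functions -/

section Shapes

variable {M : Type*} [AddCommMonoid M]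

open Classical in
theorem sum_below_eq {n : ℕ} (φ : YoungDiagram → M) (μ : Shape (n + 1)) :
    ∑ ν ∈ below μ.1, φ ν = ∑ ν : Shape n, if AddBox ν.1 μ.1 then φ ν.1 else 0 := by
  rw [← sum_filter]
  symm
  refine sum_bij (fun ν _ => ν.1) ?_ (fun _ _ _ _ h => Subtype.ext h) ?_ fun _ _ => rfl
  · exact fun ν hν => mem_below.mpr (mem_filter.mp hν).2
  · intro ν hν
    have h := mem_below.mp hν
    have hc := h.2
    rw [μ.2] at hc
    exact ⟨⟨ν, by omega⟩, mem_filter.mpr ⟨mem_univ _, h⟩, rfl⟩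

open Classical in
theorem sum_above_eq {n : ℕ} (φ : YoungDiagram → M) (μ : Shape n) :
    ∑ ν ∈ above μ.1, φ ν = ∑ ν : Shape (n + 1), if AddBox μ.1 ν.1 then φ ν.1 else 0 := by
  rw [← sum_filter]
  symm
  refine sum_bij (fun ν _ => ν.1) ?_ (fun _ _ _ _ h => Subtype.ext h) ?_ fun _ _ => rfl
  · exact fun ν hν => mem_above.mpr (mem_filter.mp hν).2
  · intro ν hν
    have h := mem_above.mp hν
    have hc := h.2
    rw [μ.2] at hc
    exact ⟨⟨ν, hc⟩, mem_filter.mpr ⟨mem_univ _, h⟩, rfl⟩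

end Shapes

open Polynomial in
-- U is adjoint to summation over covers, for which the generating functions satisfy
-- `sum_above_majSum`.
theorem sum_majSum_mul_upOp (n : ℕ) (φ : YoungDiagram → ℕ) :
    ∑ μ : Shape (n + 1), majSum (X : ℤ[X]) μ.1 * (upOp φ μ.1 : ℤ[X]) =
      qInt (n + 1) * ∑ μ : Shape n, majSum (X : ℤ[X]) μ.1 * (φ μ.1 : ℤ[X]) := by
  classical
  have h1 : ∀ μ : Shape (n + 1), majSum (X : ℤ[X]) μ.1 * (upOp φ μ.1 : ℤ[X]) =
      ∑ ν : Shape n, if AddBox ν.1 μ.1 then majSum X μ.1 * (φ ν.1 : ℤ[X]) else 0 := by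
    intro μ
    rw [upOp_apply, Nat.cast_sum, mul_sum, sum_below_eq]
  have h2 : ∀ ν : Shape n, qInt (n + 1) * (majSum (X : ℤ[X]) ν.1 * (φ ν.1 : ℤ[X])) =
      ∑ μ : Shape (n + 1), if AddBox ν.1 μ.1 then majSum X μ.1 * (φ ν.1 : ℤ[X]) else 0 := by
    intro ν
    have := sum_above_majSum ν.1
    rw [ν.2] at this
    rw [← mul_assoc, ← this, sum_mul, sum_above_eq]
  rw [mul_sum, sum_congr rfl fun μ _ => h1 μ, sum_congr rfl fun ν _ => h2 ν, sum_comm]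

open Polynomial in
theorem sum_majSum_mul_upOp_pow_rowInd (m l : ℕ) :
    ∑ μ : Shape (m + l), majSum (X : ℤ[X]) μ.1 * ((upOp ^ l) (rowInd m) μ.1 : ℤ[X]) =
      ∏ i ∈ range l, qInt (m + l - i) := by
  classical
  induction l with
  | zero =>
    change ∑ μ : Shape m, majSum (X : ℤ[X]) μ.1 * (rowInd m μ.1 : ℤ[X]) = _
    rw [sum_eq_single (oneRow m)]
    · simp [rowInd, majSum_oneRow]
    · intro μ _ hne
      have : μ.1 ≠ (oneRow m).1 := fun h => hne (Subtype.ext h)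
      simp [rowInd, this]
    · exact fun h => absurd (mem_univ _) h
  | succ l ih =>
    rw [prod_range_succ', pow_succ']
    have h := sum_majSum_mul_upOp (m + l) ((upOp ^ l) (rowInd m))
    rw [ih] at h
    refine h.trans ?_
    rw [mul_comm, Nat.sub_zero]
    congr 1
    refine prod_congr rfl fun i _ => ?_
    rw [show m + (l + 1) - (i + 1) = m + l - i by omega]

/-! ### Counting vacillating tableaux -/

theorem mult_zero {n : ℕ} (μ : Shape n) : mult 0 μ = rowInd n μ.1 := by
  classical
  rw [rowInd]
  split_ifs with h
  · have hμ : μ = oneRow n := Subtype.ext h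
    refine Fintype.card_eq_one_iff.mpr ⟨⟨(fun _ => μ, Fin.elim0), hμ, fun i => i.elim0,
      fun i => i.elim0, rfl⟩, ?_⟩
    rintro ⟨Q, h1, -, -, h2⟩
    refine Subtype.ext (Prod.ext (funext fun i => ?_) (funext fun i => i.elim0))
    obtain rfl : i = Fin.last 0 := Subsingleton.elim (α := Fin 1) i _
    exact h2
  · refine Fintype.card_eq_zero_iff.mpr ⟨?_⟩
    rintro ⟨Q, h1, -, -, h2⟩
    exact h (congrArg Subtype.val (h2.symm.trans h1))

/-- Extending a vacillating tableau by one deletion and one addition of a box. -/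
def VacillatingTableau.snoc {m r : ℕ} {μ : Shape (m + 1)} (ρ : Shape m) {κ : Shape (m + 1)}
    (hμ : AddBox ρ.1 μ.1) (hκ : AddBox ρ.1 κ.1) (Q : VacillatingTableau r κ) :
    VacillatingTableau (r + 1) μ :=
  ⟨(Fin.snoc (α := fun _ => Shape (m + 1)) Q.1.1 μ, Fin.snoc (α := fun _ => Shape m) Q.1.2 ρ), by
    refine ⟨?_, fun i => ?_, fun i => ?_, ?_⟩
    · exact (Fin.snoc_castSucc (α := fun _ : Fin (r + 2) => Shape (m + 1)) μ Q.1.1 0).trans Q.2.1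
    · induction i using Fin.lastCases with
      | last =>
        simp only [Fin.snoc_last, Fin.snoc_castSucc]
        exact Q.2.2.2.2.symm ▸ hκ
      | cast i =>
        simp only [Fin.snoc_castSucc]
        exact Q.2.2.1 i
    · induction i using Fin.lastCases with
      | last =>
        simp only [Fin.snoc_last, Fin.succ_last]
        exact hμ
      | cast i =>
        simp only [Fin.succ_castSucc, Fin.snoc_castSucc]
        exact Q.2.2.2.1 i
    · exact Fin.snoc_last (α := fun _ : Fin (r + 2) => Shape (m + 1)) μ Q.1.1⟩

theorem VacillatingTableau.snoc_bijective {m r : ℕ} (μ : Shape (m + 1)) :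
    Function.Bijective fun x : Σ y : {y : Shape m × Shape (m + 1) //
        AddBox y.1.1 μ.1 ∧ AddBox y.1.1 y.2.1}, VacillatingTableau r y.1.2 =>
      VacillatingTableau.snoc x.1.1.1 x.1.2.1 x.1.2.2 x.2 := by
  constructor
  · rintro ⟨⟨⟨ρ, κ⟩, h⟩, Q⟩ ⟨⟨⟨ρ', κ'⟩, h'⟩, Q'⟩ heq
    have h1 := congrArg (fun T => T.1.1) heq
    have h2 := congrArg (fun T => T.1.2) heq
    simp only [VacillatingTableau.snoc] at h1 h2
    obtain ⟨h1, -⟩ := Fin.snoc_inj.mp h1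
    obtain ⟨h2, rfl⟩ := Fin.snoc_inj.mp h2
    obtain rfl : κ = κ' := by
      have e1 := Q.2.2.2.2
      have e2 := Q'.2.2.2.2
      rw [h1] at e1
      exact e1.symm.trans e2
    obtain rfl : Q = Q' := Subtype.ext (Prod.ext h1 h2)
    rfl
  · rintro ⟨⟨a, b⟩, h1, h2, h3, h4⟩
    refine ⟨⟨⟨(b (Fin.last r), a (Fin.last r).castSucc), ?_, h2 (Fin.last r)⟩,
      ⟨(Fin.init a, Fin.init b), h1, fun i => h2 i.castSucc, fun i => ?_, rfl⟩⟩, ?_⟩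
    · have := h3 (Fin.last r)
      rw [Fin.succ_last, h4] at this
      exact this
    · have := h3 i.castSucc
      rw [Fin.succ_castSucc] at this
      exact this
    · refine Subtype.ext (Prod.ext ?_ ?_)
      · simp only [VacillatingTableau.snoc]
        rw [← h4]
        exact Fin.snoc_init_self a
      · exact Fin.snoc_init_self b

/-- Splitting off the last deletion and addition multiplies by UD. The size is a successor so that
the intermediate diagrams, of size n - 1, really have one box fewer. -/
theorem mult_eq {m : ℕ} (r : ℕ) (μ : Shape (m + 1)) :
    mult r μ = ((upOp * downOp) ^ r) (rowInd (m + 1)) μ.1 := by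
  classical
  induction r generalizing μ with
  | zero => exact mult_zero μ
  | succ r ih =>
    rw [mult, ← Fintype.card_of_bijective (VacillatingTableau.snoc_bijective (r := r) μ),
      Fintype.card_sigma, pow_succ', Module.End.mul_apply, Module.End.mul_apply, upOp_apply,
      sum_below_eq]
    have h1 : ∀ y : {y : Shape m × Shape (m + 1) // AddBox y.1.1 μ.1 ∧ AddBox y.1.1 y.2.1},
        Fintype.card (VacillatingTableau r y.1.2) =
          ((upOp * downOp) ^ r) (rowInd (m + 1)) y.1.2.1 := fun y => ih y.1.2
    simp only [h1]
    refine (sum_subtype ({y | AddBox y.1.1 μ.1 ∧ AddBox y.1.1 y.2.1} :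
      Finset (Shape m × Shape (m + 1))) (by simp)
      (fun y => ((upOp * downOp) ^ r) (rowInd (m + 1)) y.2.1)).symm.trans ?_
    rw [sum_filter, Fintype.sum_prod_type]
    refine sum_congr rfl fun ρ _ => ?_
    simp only [ite_and]
    split_ifs with h
    · rw [downOp_apply, sum_above_eq]
    · exact sum_const_zero

/-- The first row starts with all m + 1 boxes and loses at most one per step. -/
theorem le_rowLen_zero_add {m r : ℕ} {μ : Shape (m + 1)} (Q : VacillatingTableau r μ) :
    m + 1 ≤ μ.1.rowLen 0 + r := by
  have key : ∀ i : Fin (r + 1), m + 1 ≤ (Q.1.1 i).1.rowLen 0 + i := by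
    intro i
    induction i using Fin.induction with
    | zero => rw [Q.2.1, rowLen_oneRow, if_pos rfl]; exact Nat.le_add_right _ _
    | succ i ih =>
      have h1 := le_iff_rowLen.mp (Q.2.2.2.1 i).1 0
      obtain ⟨k, hk⟩ := (Q.2.2.1 i).exists_addAt
      have h2 := hk 0
      rw [Fin.val_castSucc] at ih
      rw [Fin.val_succ]
      split_ifs at h2 <;> omega
  have := key (Fin.last r)
  rwa [Q.2.2.2.2, Fin.val_last] at this

theorem mult_eq_zero_of_notMem_Lam {m r : ℕ} {μ : Shape (m + 1)} (h : μ ∉ Lam (m + 1) r) :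
    mult r μ = 0 := by
  refine Fintype.card_eq_zero_iff.mpr ⟨fun Q => h ?_⟩
  have h1 := le_rowLen_zero_add Q
  have h2 := card_eq_sum_rowLen μ.1 (N := μ.1.colLen 0) fun i hi => by
    by_contra hne
    have := YoungDiagram.mem_iff_lt_colLen.mp
      (YoungDiagram.mem_iff_lt_rowLen.mpr (Nat.pos_of_ne_zero hne))
    omega
  rw [μ.2] at h2
  simp only [Lam, mem_filter, mem_univ, true_and]
  have hpos : 0 < μ.1.colLen 0 := by
    by_contra hz
    rw [Nat.eq_zero_of_not_pos hz, range_zero, sum_empty] at h2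
    omega
  rw [range_eq_Ico, sum_eq_sum_Ico_succ_bot hpos, zero_add] at h2
  omega

/-! ### Assembling the identity -/

theorem dPoly_eq_sum (m : ℕ) {r : ℕ} (hr : 0 < r) :
    dPoly (m + 1) r =
      ∑ μ ∈ Lam (m + 1) r, fPoly μ * (mult r μ : Polynomial ℤ) := by
  rw [sum_subset (subset_univ _) fun μ _ hμ => by
    rw [mult_eq_zero_of_notMem_Lam hμ, Nat.cast_zero, mul_zero]]
  rw [dPoly, sum_Icc_stirling_mul hr]
  have h1 : ∀ μ : Shape (m + 1), fPoly μ * (mult r μ : Polynomial ℤ) =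
      ∑ l ∈ range (m + 1 + 1), (stirling r l : Polynomial ℤ) *
        (majSum Polynomial.X μ.1 * ((upOp ^ l) (rowInd (m + 1 - l)) μ.1 : Polynomial ℤ)) := by
    intro μ
    rw [mult_eq, upOp_mul_downOp_pow_rowInd, ← majSum_X, Finset.sum_apply, Nat.cast_sum, mul_sum]
    refine sum_congr rfl fun l _ => ?_
    rw [Pi.smul_apply, smul_eq_mul, Nat.cast_mul]
    ring
  rw [sum_congr rfl fun μ _ => h1 μ, sum_comm]
  refine sum_congr rfl fun l hl => ?_
  rw [← mul_sum]
  congr 1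
  obtain ⟨k, hk⟩ := Nat.exists_eq_add_of_le' (Nat.lt_succ_iff.mp (mem_range.mp hl))
  rw [hk, Nat.add_sub_cancel]
  exact (sum_majSum_mul_upOp_pow_rowInd k l).symm

end QPartition

theorem mainTheorem4 (n r : ℕ) (hn : 0 < n) (hr : 0 < r) :
    QPartition.dPoly n r =
        ∑ μ ∈ QPartition.Lam n r,
          QPartition.fPoly μ * (QPartition.mult r μ : Polynomial ℤ) ∧
      (QPartition.dPoly n r).eval 1 = (n : ℤ) ^ r ∧
      (r ≤ n → (QPartition.dPoly n r).eval 0 = (QPartition.bellNumber r : ℤ)) := by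
  obtain ⟨m, rfl⟩ := Nat.exists_eq_succ_of_ne_zero hn.ne'
  exact ⟨QPartition.dPoly_eq_sum m hr, QPartition.eval_dPoly_one _ hr,
    QPartition.eval_dPoly_zero hr⟩
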